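/- **Setting.** Let a Markov decision process with state space $\mathcal S$, transition kernel $P$, reward function and discount factor $\gamma\in[0,1)$ be given, together with a stationary policy $\pi$, a stationary distribution $\nu$ of the chain induced by $\pi$, and a feature map $\phi:\mathcal S\to\mathbb R^d$. Write $r(s)$ for the reward in state $s$ under $\pi$, and assume $|r(s)|\le 1$ and $\|\phi(s)\|\le 1$ for all $s$, and that the features have full rank (no nonzero $x\in\mathbb R^d$ satisfies $\phi(s)^\top x=0$ for $\nu$-almost every $s$). Let $(s_n,s_n')_{n\ge 0}$ be i.i.d., $s_n\sim\nu$ and $s_n'$ the successor of $s_n$ under $\pi$; write $\phi_n=\phi(s_n)$, $\phi_n'=\phi(s_n')$, $r_n=r(s_n)$, and $\delta_n(\theta)=r_n+\gamma\theta^\top\phi_n'-\theta^\top\phi_n$. Put $A=\mathbb E[\phi(\phi-\gamma\phi')^\top]$, $C=\mathbb E[\phi\phi^\top]$, $b=\mathbb E[r\phi]$, where $(\phi,\phi',r)$ is distributed as one sample. Consider one of the following algorithms, given by sampled directions $g^1_n(\theta,w)$, $g^2_n(\theta,w)$ whose expectations have the form $h_i(\theta,w)=v_i-\Gamma_i\theta-W_iw$: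 * GTD(0): $g^1_n=(\phi_n-\gamma\phi_n')\phi_n^\top w$ and $g^2_n=\delta_n(\theta)\phi_n-w$; $h_1=A^\top w$ and $h_2=b-A\theta-w$. * GTD2: $g^1_n=(\phi_n-\gamma\phi_n')\phi_n^\top w$ and $g^2_n=\delta_n(\theta)\phi_n-\phi_n\phi_n^\top w$; $h_1=A^\top w$ and $h_2=b-A\theta-Cw$. * TDC: $g^1_n=\delta_n(\theta)\phi_n-\gamma\phi_n'\phi_n^\top w$ and $g^2_n=\delta_n(\theta)\phi_n-\phi_n\phi_n^\top w$; $h_1=b-A\theta+(A^\top-C)w$ and $h_2=b-A\theta-Cw$. Let $\lambda(\theta)=W_2^{-1}(v_2-\Gamma_2\theta)$ and $\theta^*=X_1^{-1}b_1$, where $X_1=\Gamma_1-W_1W_2^{-1}\Gamma_2$ and $b_1=v_1-W_1W_2^{-1}v_2$. Fix $R_1,R_2>0$ such that $\|\theta^*\|\le R_1/4$, and $\|\lambda(\theta)\|\le R_2/4$ whenever $\|\theta\|\le R_1/2$. For $n$ a power of $2$ (including $1$) let $\Pi_{n,R}$ be the projection onto the closed ball of radius $R$ about $0$; for every other $n$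 let $\Pi_{n,R}$ be the identity. The sparsely projected iterates are $$\theta_{n+1}=\Pi_{n+1,R_1/2}\big(\theta_n+\alpha_n\,g^1_n(\theta_n,w_n)\big),\qquad w_{n+1}=\Pi_{n+1,R_2/2}\big(w_n+\beta_n\,g^2_n(\theta_n,w_n)\big),\qquad n\ge 0,$$ with arbitrary initial values $(\theta_0,w_0)$, possibly random but independent of the samples. Let $z_n=w_n-\lambda(\theta_n)$. **Statement.** Let $\kappa\in(0,1)$, $\alpha_n=(n+1)^{-(1-\kappa)}$ and $\beta_n=(n+1)^{-\frac23(1-\kappa)}$. Then each of the three algorithms converges at rate $O(n^{-1/3+\kappa/3})$ with high probability, in the following sense. 1. For every $\delta\in(0,1)$ there is a constant $K>0$ such that, for all $n\ge 1$, $$\Pr\big\{\max(\|\theta_n-\theta^*\|,\|z_n\|)\le K\,n^{-1/3+\kappa/3}\big\}\ge 1-\delta .$$ 2. There are constants $K,c>0$, not depending on $\delta$, such that, for all $n>3$ and all $\delta\in(0,1)$ with $\delta\ge \exp\!\big(-c\,n^{\frac23(1-\kappa)}\big)$, $$\Pr\big\{\max(\|\theta_n-\theta^*\|,\|z_n\|)\le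 K\,n^{-1/3+\kappa/3}\sqrt{\ln(n/\delta)}\big\}\ge 1-\delta .$$ The constants do not depend on the probability space, on $n$, or on the initial values. -/

import Mathlib

open MeasureTheory ProbabilityTheory
open scoped InnerProductSpace

namespace GTD

/-- Parameter and feature space `ℝ^d` with the Euclidean norm. -/
abbrev Vec (d : ℕ) : Type := EuclideanSpace ℝ (Fin d)

/-- A `d × d` real matrix, as an operator on `ℝ^d` (normed by the operator norm). -/
abbrev Mat (d : ℕ) : Type := Vec d →L[ℝ] Vec d

/-! ### Linear two-timescale stochastic approximation -/

/-- The coefficients of the two drifts `hᵢ(θ, w) = vᵢ - Γᵢ θ - Wᵢ w`. -/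
structure TwoTimescale (d : ℕ) where
  v₁ : Vec d
  Γ₁ : Mat d
  W₁ : Mat d
  v₂ : Vec d
  Γ₂ : Mat d
  W₂ : Mat d

namespace TwoTimescale

variable {d : ℕ} (T : TwoTimescale d)

/-- Slow drift. -/
noncomputable def h₁ (θ w : Vec d) : Vec d := T.v₁ - T.Γ₁ θ - T.W₁ w

/-- Fast drift. -/
noncomputable def h₂ (θ w : Vec d) : Vec d := T.v₂ - T.Γ₂ θ - T.W₂ w

/-- `X₁ = Γ₁ - W₁ W₂⁻¹ Γ₂`. -/
noncomputable def X₁ : Mat d := T.Γ₁ - T.W₁ ∘L T.W₂.inverse ∘L T.Γ₂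

/-- `b₁ = v₁ - W₁ W₂⁻¹ v₂`. -/
noncomputable def b₁ : Vec d := T.v₁ - T.W₁ (T.W₂.inverse T.v₂)

/-- `λ(θ) = W₂⁻¹ (v₂ - Γ₂ θ)`, the equilibrium of the fast ODE for frozen `θ`. -/
noncomputable def lam (θ : Vec d) : Vec d := T.W₂.inverse (T.v₂ - T.Γ₂ θ)

/-- `θ* = X₁⁻¹ b₁`, the equilibrium of the slow ODE. -/
noncomputable def θstar : Vec d := T.X₁.inverse T.b₁

end TwoTimescale

/-! ### Sparse projection -/

/-- Projection onto the closed ball of radius `R` centred at the origin. -/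
noncomputable def ballProj {d : ℕ} (R : ℝ) (x : Vec d) : Vec d :=
  if ‖x‖ ≤ R then x else (R / ‖x‖) • x

open Classical in
/-- `Π_{n,R}`: projection onto the `R`-ball if `n` is a power of two, the identity otherwise. -/
noncomputable def sparseProj {d : ℕ} (n : ℕ) (R : ℝ) (x : Vec d) : Vec d :=
  if ∃ k : ℕ, n = 2 ^ k then ballProj R x else x

/-! ### Linear policy evaluation -/

/-- A Markov decision process: transition kernel, reward function and discount factor. -/
structure MDP (S Act : Type*) [MeasurableSpace S] [MeasurableSpace Act] where
  P : Kernel (S × Act) S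
  markov : IsMarkovKernel P
  R : S × Act → ℝ
  R_meas : Measurable R
  γ : ℝ
  γ_nonneg : 0 ≤ γ
  γ_lt_one : γ < 1

attribute [instance] MDP.markov

/-- A linear policy evaluation problem: an MDP, a stationary deterministic policy `π`,
a stationary distribution `ν` of the chain induced by `π`, and a feature map `φ`. -/
structure PolicyEval (S Act : Type*) [MeasurableSpace S] [MeasurableSpace Act] (d : ℕ)
    extends MDP S Act where
  π : S → Act
  π_meas : Measurable π
  ν : Measure S
  ν_prob : IsProbabilityMeasure ν
  stationary : (P.comap (fun s => (s, π s)) (measurable_id.prodMk π_meas)).Invariant ν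
  φ : S → Vec d
  φ_meas : Measurable φ

attribute [instance] PolicyEval.ν_prob

namespace PolicyEval

variable {S Act : Type*} [MeasurableSpace S] [MeasurableSpace Act] {d : ℕ}
variable (E : PolicyEval S Act d)

/-- Transition kernel of the chain induced by the policy. -/
noncomputable def chain : Kernel S S :=
  E.P.comap (fun s => (s, E.π s)) (measurable_id.prodMk E.π_meas)

/-- Reward received in a state under the policy. -/
def r (s : S) : ℝ := E.R (s, E.π s)

/-- Law of one sample `(s, s')`: `s` has the stationary distribution, and `s'` is the state
that follows `s` in the induced chain. -/
noncomputable def sampleLaw : Measure (S × S) := E.ν ⊗ₘ E.chain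

/-- `A = 𝔼[φ (φ - γ φ')ᵀ]`; here `rankOne ℝ x y` is the matrix `x yᵀ`. -/
noncomputable def A : Mat d :=
  ∫ x, InnerProductSpace.rankOne ℝ (E.φ x.1) (E.φ x.1 - E.γ • E.φ x.2) ∂E.sampleLaw

/-- `C = 𝔼[φ φᵀ]`. -/
noncomputable def C : Mat d :=
  ∫ x, InnerProductSpace.rankOne ℝ (E.φ x.1) (E.φ x.1) ∂E.sampleLaw

/-- `b = 𝔼[r φ]`. -/
noncomputable def b : Vec d := ∫ x, E.r x.1 • E.φ x.1 ∂E.sampleLaw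

/-- The features have full column rank: no nonzero linear combination of the `d` features
vanishes on almost all states.  (For a finite state space in which every state has positive
stationary probability: the feature matrix `Φ` has rank `d`.) -/
def FullRank : Prop := ∀ x : Vec d, (∀ᵐ s ∂E.ν, ⟪E.φ s, x⟫_ℝ = 0) → x = 0

/-- Temporal difference `δ = r + γ θᵀφ' - θᵀφ` of a sample at `θ`. -/
noncomputable def tdError (x : S × S) (θ : Vec d) : ℝ :=
  E.r x.1 + E.γ * ⟪θ, E.φ x.2⟫_ℝ - ⟪θ, E.φ x.1⟫_ℝ

end PolicyEval

/-! ### The GTD family -/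

/-- The three gradient temporal difference algorithms. -/
inductive Algorithm where
  | GTD0
  | GTD2
  | TDC

namespace Algorithm

variable {S Act : Type*} [MeasurableSpace S] [MeasurableSpace Act] {d : ℕ}

/-- The expected updates of the algorithms, as linear two-timescale drifts:
* GTD(0): `h₁ = Aᵀ w`, `h₂ = b - A θ - w`;
* GTD2: `h₁ = Aᵀ w`, `h₂ = b - A θ - C w`;
* TDC: `h₁ = b - A θ + (Aᵀ - C) w`, `h₂ = b - A θ - C w`. -/
noncomputable def drift (E : PolicyEval S Act d) : Algorithm → TwoTimescale d
  | GTD0 => ⟨0, 0, -E.A.adjoint, E.b, E.A, ContinuousLinearMap.id ℝ (Vec d)⟩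
  | GTD2 => ⟨0, 0, -E.A.adjoint, E.b, E.A, E.C⟩
  | TDC => ⟨E.b, E.A, E.C - E.A.adjoint, E.b, E.A, E.C⟩

/-- Sampled slow direction `h₁(θ, w) + M⁽¹⁾` for the sample `x = (s, s')`. -/
noncomputable def slowDir (E : PolicyEval S Act d) :
    Algorithm → S × S → Vec d → Vec d → Vec d
  | GTD0, x, _, w => ⟪E.φ x.1, w⟫_ℝ • (E.φ x.1 - E.γ • E.φ x.2)
  | GTD2, x, _, w => ⟪E.φ x.1, w⟫_ℝ • (E.φ x.1 - E.γ • E.φ x.2)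
  | TDC, x, θ, w => E.tdError x θ • E.φ x.1 - (E.γ * ⟪E.φ x.1, w⟫_ℝ) • E.φ x.2

/-- Sampled fast direction `h₂(θ, w) + M⁽²⁾` for the sample `x = (s, s')`. -/
noncomputable def fastDir (E : PolicyEval S Act d) :
    Algorithm → S × S → Vec d → Vec d → Vec d
  | GTD0, x, θ, w => E.tdError x θ • E.φ x.1 - w
  | GTD2, x, θ, w => E.tdError x θ • E.φ x.1 - ⟪E.φ x.1, w⟫_ℝ • E.φ x.1
  | TDC, x, θ, w => E.tdError x θ • E.φ x.1 - ⟪E.φ x.1, w⟫_ℝ • E.φ x.1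

/-- The sparsely projected iterates `(θ'ₙ, w'ₙ)` driven by the samples `x₀, x₁, …`, with stepsizes
`αₙ, βₙ`, started at `(θ₀, w₀)`; at powers of two, `θ'` and `w'` are projected onto the balls of
radius `R₁ / 2` and `R₂ / 2`. -/
noncomputable def iter (E : PolicyEval S Act d) (alg : Algorithm) (α β : ℕ → ℝ) (R₁ R₂ : ℝ)
    (x : ℕ → S × S) (θ₀ w₀ : Vec d) : ℕ → Vec d × Vec d
  | 0 => (θ₀, w₀)
  | n + 1 =>
    let p := iter E alg α β R₁ R₂ x θ₀ w₀ n
    (sparseProj (n + 1) (R₁ / 2) (p.1 + α n • alg.slowDir E (x n) p.1 p.2),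
      sparseProj (n + 1) (R₂ / 2) (p.2 + β n • alg.fastDir E (x n) p.1 p.2))

/-- `max (‖θ - θ*‖, ‖z‖)` with `z = w - λ(θ)`, at the pair `p = (θ, w)`. -/
noncomputable def err (E : PolicyEval S Act d) (alg : Algorithm) (p : Vec d × Vec d) : ℝ :=
  max ‖p.1 - (alg.drift E).θstar‖ ‖p.2 - (alg.drift E).lam p.1‖

end Algorithm

/-- A run of the sampling: `X₀, X₁, …` are i.i.d. samples `(sₙ, s'ₙ)`, and the initial values are
random vectors independent of the samples (in particular, they may be constant). -/
structure IsRun {S Act Ω : Type*} [MeasurableSpace S] [MeasurableSpace Act] [MeasurableSpace Ω]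
    {d : ℕ} (E : PolicyEval S Act d) (μ : Measure Ω) (X : ℕ → Ω → S × S)
    (θ₀ w₀ : Ω → Vec d) : Prop where
  X_meas : ∀ n, Measurable (X n)
  θ₀_meas : Measurable θ₀
  w₀_meas : Measurable w₀
  law : ∀ n, μ.map (X n) = E.sampleLaw
  indep : iIndepFun X μ
  indep_init : IndepFun (fun ω => (θ₀ ω, w₀ ω)) (fun ω n => X n ω) μ

end GTD

/-! The errors are measured by `x = θ - θ*` and `z = w - λ(θ)`. In these coordinates the mean drifts
are `-X₁ x - W₁ z` and `-W₂ z`. For all three algorithms `X₁ = Aᵀ W₂⁻¹ A`, with `W₂` equal to the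
identity or `C`. Stationarity of `ν` and full rank make `A` and `C` coercive, hence `X₁` and `W₂` as
well (`exists_coercive_drift`).

Two Lyapunov functions are used: `‖z‖²`, contracting at rate `β`, and `‖x‖² + k (α/β) ‖z‖²`,
contracting at rate `α`. The weight `α/β` turns the dissipation of `‖z‖²` into a term of order `α`,
and a large `k` lets this term absorb the coupling `W₁ z`. Since `α² = β³`, noise and the motion of
`λ(θ)` balance contraction at level `β` in both cases. The errors are therefore of order `√β`, which
is the claimed rate. While the iterates stay in a bounded box, the noise is bounded and enters the
squared norms with size proportional to the norm, so Hoeffding's lemma gives a drift inequality for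
the exponential moment of `s V / β` (`lyapunov_exp_step`, `exp_step_fast`, `exp_step_slow`).
Convexity of `exp` propagates it without accumulating constants (`setLIntegral_exp_step_le`).

Boundedness comes from the sparse projection. At `n₀ = 2 ^ i` the iterate lies in a fixed ball
whatever happened before. The chain is followed on `[n₀, 4 n₀)` until an unprojected step leaves a
good set, which is chosen so that the projection at `2 n₀` is inactive. Between `n₀` and `2 n₀` the
sum of the `α` is at least of order `n₀ ^ κ`, so the initial value is forgotten. Markov's inequality
bounds both the exit probability and the deviation at a time `n` in `[2 n₀, 4 n₀)`
(`epoch_deviation_le`). The finitely many remaining times are covered by a deterministic bound that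
starts from the projection at time `1`. -/

namespace GTD

/-! ### Coercive, not necessarily symmetric, operators. -/

section LinearAlgebra

variable {d : ℕ}

/-- `T` is coercive with constant `m`. -/
def Coercive (m : ℝ) (T : Mat d) : Prop := ∀ x, m * ‖x‖ ^ 2 ≤ ⟪x, T x⟫_ℝ

/-- The quadratic form attains a positive minimum on the compact unit sphere, and homogeneity does
the rest. -/
lemma exists_coercive {T : Mat d} (h : ∀ x ≠ 0, 0 < ⟪x, T x⟫_ℝ) :
    ∃ m : ℝ, 0 < m ∧ Coercive m T := by
  rcases (Metric.sphere (0 : Vec d) 1).eq_empty_or_nonempty with he | hne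
  -- The sphere is empty only when `d = 0`, where any constant works.
  · refine ⟨1, one_pos, fun x => ?_⟩
    by_cases hx : x = 0
    · simp [hx]
    · exfalso
      have : (‖x‖⁻¹ • x) ∈ Metric.sphere (0 : Vec d) 1 := by
        simp [norm_smul, hx]
      simp [he] at this
  · obtain ⟨y, hy, hmin⟩ := (isCompact_sphere (0 : Vec d) 1).exists_isMinOn hne
      (f := fun x => ⟪x, T x⟫_ℝ) (by fun_prop)
    have hy1 : ‖y‖ = 1 := by simpa using hy
    have hy0 : y ≠ 0 := by
      rintro rfl; simp at hy1
    refine ⟨_, h y hy0, fun x => ?_⟩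
    by_cases hx : x = 0
    · simp [hx]
    · have hn : 0 < ‖x‖ := norm_pos_iff.mpr hx
      have hm : (‖x‖⁻¹ • x) ∈ Metric.sphere (0 : Vec d) 1 := by
        simp [norm_smul, hx]
      have := hmin hm
      simp only [map_smul, inner_smul_left, inner_smul_right, Set.mem_ofPred_eq] at this
      have h2 : ⟪y, T y⟫_ℝ * ‖x‖ ^ 2 ≤ (‖x‖⁻¹ * (‖x‖⁻¹ * ⟪x, T x⟫_ℝ)) * ‖x‖ ^ 2 := by
        gcongr; simpa using this
      calc _ ≤ _ := h2
        _ = ⟪x, T x⟫_ℝ := by field_simp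

lemma Coercive.isInvertible {m : ℝ} (hm : 0 < m) {T : Mat d} (h : Coercive m T) :
    T.IsInvertible := by
  have hinj : Function.Injective (T : Vec d →ₗ[ℝ] Vec d) := by
    rw [← LinearMap.ker_eq_bot, LinearMap.ker_eq_bot']
    intro x hx
    have := h x
    have hx' : T x = 0 := hx
    rw [hx', inner_zero_right] at this
    have h2 : ‖x‖ ^ 2 ≤ 0 := by
      by_contra hc
      push Not at hc
      nlinarith [mul_pos hm hc]
    have h3 : ‖x‖ = 0 := by nlinarith [norm_nonneg x]
    exact norm_eq_zero.mp h3
  refine ⟨(LinearEquiv.ofInjectiveEndo _ hinj).toContinuousLinearEquiv, ?_⟩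
  ext x
  rfl

lemma Coercive.mono {m m' : ℝ} (hm : m' ≤ m) {T : Mat d} (h : Coercive m T) : Coercive m' T :=
  fun x => le_trans (by gcongr) (h x)

/-- If `A` and `W` are coercive, so is `Aᵀ W⁻¹ A`. -/
lemma exists_coercive_congruence {a m : ℝ} (ha : 0 < a) (hm : 0 < m) {A W : Mat d}
    (hA : Coercive a A) (hW : Coercive m W) :
    ∃ c : ℝ, 0 < c ∧ Coercive c (A.adjoint ∘L W.inverse ∘L A) := by
  refine exists_coercive fun x hx => ?_
  have hAi := hA.isInvertible ha
  have hWi := hW.isInvertible hm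
  have hAx : A x ≠ 0 := fun h0 => hx (hAi.injective (by simpa using h0))
  -- With `W y = A x`, the form of `Aᵀ W⁻¹ A` at `x` is that of `W` at `y`.
  set y := W.inverse (A x) with hy
  have hWy : W y = A x := hWi.self_apply_inverse _
  have hy0 : y ≠ 0 := fun h0 => hAx (by rw [← hWy, h0, map_zero])
  have h1 : ⟪x, (A.adjoint ∘L W.inverse ∘L A) x⟫_ℝ = ⟪y, W y⟫_ℝ := by
    simp only [ContinuousLinearMap.comp_apply, ContinuousLinearMap.adjoint_inner_right]
    rw [← hy, hWy, real_inner_comm]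
  rw [h1]
  refine lt_of_lt_of_le ?_ (hW y)
  have := norm_pos_iff.mpr hy0
  positivity

end LinearAlgebra

/-! ### Drifts centred at their equilibria. -/

namespace TwoTimescale

variable {d : ℕ} {T : TwoTimescale d}

lemma W₂_lam (hW : T.W₂.IsInvertible) (θ : Vec d) : T.W₂ (T.lam θ) = T.v₂ - T.Γ₂ θ :=
  hW.self_apply_inverse _

lemma h₂_eq (hW : T.W₂.IsInvertible) (θ w : Vec d) : T.h₂ θ w = -T.W₂ (w - T.lam θ) := by
  rw [map_sub, W₂_lam hW, h₂]; abel

/-- Substituting `w = λ(θ) + (w - λ(θ))` eliminates the fast variable, leaving `X₁` acting on the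
slow error and `W₁` on the tracking error. -/
lemma h₁_eq (hX : T.X₁.IsInvertible) (θ w : Vec d) :
    T.h₁ θ w = -T.X₁ (θ - T.θstar) - T.W₁ (w - T.lam θ) := by
  have h1 : T.X₁ T.θstar = T.b₁ := hX.self_apply_inverse _
  rw [map_sub, h1, h₁, b₁, X₁, lam]
  simp only [sub_apply, ContinuousLinearMap.comp_apply, map_sub]
  abel

/-- The equilibrium of the fast variable moves when `θ` does; this is the extra term `D g₁` in every
fast increment below. -/
lemma lam_sub (θ θ' : Vec d) : T.lam θ' - T.lam θ = -(T.W₂.inverse ∘L T.Γ₂) (θ' - θ) := by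
  simp only [lam, ContinuousLinearMap.comp_apply, map_sub]
  abel

lemma continuous_lam : Continuous T.lam := by
  unfold lam; fun_prop

end TwoTimescale

/-- `g₁` and `g₂` are sampled directions with means `h₁` and `h₂`, of at most linear growth. -/
structure IsSampling {d : ℕ} {𝒳 : Type*} [MeasurableSpace 𝒳] (T : TwoTimescale d) (ℓ : Measure 𝒳)
    (g₁ g₂ : 𝒳 → Vec d → Vec d → Vec d) : Prop where
  meas₁ : Measurable fun q : (Vec d × Vec d) × 𝒳 => g₁ q.2 q.1.1 q.1.2
  meas₂ : Measurable fun q : (Vec d × Vec d) × 𝒳 => g₂ q.2 q.1.1 q.1.2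
  mean₁ : ∀ θ w, ∫ ξ, g₁ ξ θ w ∂ℓ = T.h₁ θ w
  mean₂ : ∀ θ w, ∫ ξ, g₂ ξ θ w ∂ℓ = T.h₂ θ w
  bound₁ : ∀ ξ θ w, ‖g₁ ξ θ w‖ ≤ 2 * (1 + ‖θ‖ + ‖w‖)
  bound₂ : ∀ ξ θ w, ‖g₂ ξ θ w‖ ≤ 2 * (1 + ‖θ‖ + ‖w‖)

/-! ### Sample means and coercivity of `A` and `C`. -/

namespace PolicyEval

variable {S Act : Type*} [MeasurableSpace S] [MeasurableSpace Act] {d : ℕ}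
variable (E : PolicyEval S Act d)

instance : IsMarkovKernel E.chain := by unfold chain; infer_instance

instance : IsProbabilityMeasure E.sampleLaw := by unfold sampleLaw; infer_instance

lemma sampleLaw_map_fst : E.sampleLaw.map Prod.fst = E.ν := Measure.fst_compProd _ _

lemma sampleLaw_map_snd : E.sampleLaw.map Prod.snd = E.ν := by
  have := Measure.snd_compProd E.ν E.chain
  rw [sampleLaw]
  exact this.trans E.stationary

lemma measurable_r : Measurable E.r :=
  E.R_meas.comp (measurable_id.prodMk E.π_meas)

lemma measurable_φ_fst : Measurable fun x : S × S => E.φ x.1 := E.φ_meas.comp measurable_fst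

lemma measurable_φ_snd : Measurable fun x : S × S => E.φ x.2 := E.φ_meas.comp measurable_snd

lemma measurable_feature_diff : Measurable fun x : S × S => E.φ x.1 - E.γ • E.φ x.2 :=
  E.measurable_φ_fst.sub (E.measurable_φ_snd.const_smul E.γ)

lemma measurable_r_fst : Measurable fun x : S × S => E.r x.1 := E.measurable_r.comp measurable_fst

variable {E}

lemma norm_feature_diff_le (hφ : ∀ s, ‖E.φ s‖ ≤ 1) (x : S × S) :
    ‖E.φ x.1 - E.γ • E.φ x.2‖ ≤ 2 := by
  have h1 := hφ x.1
  have h2 := hφ x.2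
  have hγ := E.γ_nonneg
  have hγ1 := E.γ_lt_one.le
  calc _ ≤ ‖E.φ x.1‖ + ‖E.γ • E.φ x.2‖ := norm_sub_le _ _
    _ ≤ 1 + 1 * 1 := by
      rw [norm_smul, Real.norm_of_nonneg hγ]; gcongr
    _ = 2 := by norm_num

lemma continuous_rankOne : Continuous fun q : Vec d × Vec d =>
    (InnerProductSpace.rankOne ℝ q.1 q.2 : Mat d) :=
  ((InnerProductSpace.rankOne (E := Vec d) (F := Vec d) ℝ).continuous.comp
    continuous_fst).clm_apply continuous_snd

lemma aestronglyMeasurable_rankOne {μ : Measure S} {f : S → Vec d × Vec d}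
    (h : AEStronglyMeasurable f μ) :
    AEStronglyMeasurable (fun x => (InnerProductSpace.rankOne ℝ (f x).1 (f x).2 : Mat d)) μ :=
  continuous_rankOne.comp_aestronglyMeasurable h

lemma integrable_rankOne {ψ χ : S × S → Vec d} (hψ : Measurable ψ) (hχ : Measurable χ) {a b : ℝ}
    (ha : ∀ x, ‖ψ x‖ ≤ a) (hb : ∀ x, ‖χ x‖ ≤ b) :
    Integrable (fun x => (InnerProductSpace.rankOne ℝ (ψ x) (χ x) : Mat d)) E.sampleLaw := by
  refine Integrable.of_bound (C := a * b) ?_ (Filter.Eventually.of_forall fun x => ?_)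
  · exact aestronglyMeasurable_rankOne (f := fun x => (ψ x, χ x))
      (hψ.prodMk hχ).aestronglyMeasurable
  · rw [InnerProductSpace.norm_rankOne]
    have := (norm_nonneg _).trans (ha x)
    gcongr
    exacts [ha x, hb x]

lemma A_apply (hφ : ∀ s, ‖E.φ s‖ ≤ 1) (v : Vec d) :
    E.A v = ∫ x, ⟪E.φ x.1 - E.γ • E.φ x.2, v⟫_ℝ • E.φ x.1 ∂E.sampleLaw := by
  rw [A, ContinuousLinearMap.integral_apply]
  · simp only [InnerProductSpace.rankOne_apply]
  · exact integrable_rankOne E.measurable_φ_fst E.measurable_feature_diff (fun x => hφ x.1)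
      (norm_feature_diff_le hφ)

lemma C_apply (hφ : ∀ s, ‖E.φ s‖ ≤ 1) (v : Vec d) :
    E.C v = ∫ x, ⟪E.φ x.1, v⟫_ℝ • E.φ x.1 ∂E.sampleLaw := by
  rw [C, ContinuousLinearMap.integral_apply]
  · simp [InnerProductSpace.rankOne_apply]
  · exact integrable_rankOne E.measurable_φ_fst E.measurable_φ_fst (fun x => hφ x.1)
      (fun x => hφ x.1)

lemma abs_inner_feature_le (hφ : ∀ s, ‖E.φ s‖ ≤ 1) (s : S) (v : Vec d) :
    |⟪E.φ s, v⟫_ℝ| ≤ ‖v‖ :=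
  (abs_real_inner_le_norm _ _).trans (mul_le_of_le_one_left (norm_nonneg _) (hφ s))

lemma integrable_of_norm_le {F : Type*} [NormedAddCommGroup F] [MeasurableSpace F] [BorelSpace F]
    [SecondCountableTopology F] {f : S × S → F} (hf : Measurable f) (c : ℝ)
    (h : ∀ x, ‖f x‖ ≤ c) : Integrable f E.sampleLaw :=
  Integrable.of_bound hf.aestronglyMeasurable c (Filter.Eventually.of_forall h)

lemma measurable_inner_fst (v : Vec d) : Measurable fun x : S × S => ⟪E.φ x.1, v⟫_ℝ :=
  E.measurable_φ_fst.inner_const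

lemma measurable_inner_snd (v : Vec d) : Measurable fun x : S × S => ⟪E.φ x.2, v⟫_ℝ :=
  E.measurable_φ_snd.inner_const

lemma integrable_inner_smul {ψ χ : S × S → Vec d} (hψ : Measurable ψ) (hχ : Measurable χ) {a b : ℝ}
    (ha : ∀ x, ‖ψ x‖ ≤ a) (hb : ∀ x, ‖χ x‖ ≤ b) (v : Vec d) :
    Integrable (fun x => ⟪ψ x, v⟫_ℝ • χ x) E.sampleLaw := by
  refine integrable_of_norm_le
    (Measurable.smul (f := fun x => ⟪ψ x, v⟫_ℝ) hψ.inner_const hχ) (a * ‖v‖ * b) fun x => ?_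
  rw [norm_smul]
  have h1 : ‖⟪ψ x, v⟫_ℝ‖ ≤ a * ‖v‖ := (norm_inner_le_norm _ _).trans (by gcongr; exact ha x)
  have := (norm_nonneg _).trans h1
  gcongr
  exact hb x

lemma adjoint_A_apply (hφ : ∀ s, ‖E.φ s‖ ≤ 1) (v : Vec d) :
    E.A.adjoint v = ∫ x, ⟪E.φ x.1, v⟫_ℝ • (E.φ x.1 - E.γ • E.φ x.2) ∂E.sampleLaw := by
  have hm := E.measurable_feature_diff
  refine ext_inner_left ℝ fun u => ?_
  rw [ContinuousLinearMap.adjoint_inner_right, A_apply hφ, real_inner_comm,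
    ← integral_inner (integrable_inner_smul hm E.measurable_φ_fst (norm_feature_diff_le hφ)
      (fun x => hφ x.1) u),
    ← integral_inner (integrable_inner_smul E.measurable_φ_fst hm (fun x => hφ x.1)
      (norm_feature_diff_le hφ) v)]
  refine integral_congr_ae (Filter.Eventually.of_forall fun x => ?_)
  simp only [inner_smul_right]
  rw [real_inner_comm v, real_inner_comm u, mul_comm]

lemma inner_C (hφ : ∀ s, ‖E.φ s‖ ≤ 1) (v : Vec d) :
    ⟪v, E.C v⟫_ℝ = ∫ x, ⟪E.φ x.1, v⟫_ℝ ^ 2 ∂E.sampleLaw := by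
  rw [C_apply hφ, ← integral_inner (integrable_inner_smul E.measurable_φ_fst E.measurable_φ_fst
    (fun x => hφ x.1) (fun x => hφ x.1) v)]
  refine integral_congr_ae (Filter.Eventually.of_forall fun x => ?_)
  simp only [inner_smul_right]
  rw [real_inner_comm v, sq]

lemma integral_inner_snd_sq (v : Vec d) :
    ∫ x, ⟪E.φ x.2, v⟫_ℝ ^ 2 ∂E.sampleLaw = ∫ x, ⟪E.φ x.1, v⟫_ℝ ^ 2 ∂E.sampleLaw := by
  have hf : Measurable fun s => ⟪E.φ s, v⟫_ℝ ^ 2 := (E.φ_meas.inner_const).pow_const 2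
  have h1 := integral_map (μ := E.sampleLaw) measurable_snd.aemeasurable
    hf.aestronglyMeasurable
  have h2 := integral_map (μ := E.sampleLaw) measurable_fst.aemeasurable
    hf.aestronglyMeasurable
  rw [sampleLaw_map_snd] at h1
  rw [sampleLaw_map_fst] at h2
  exact h1.symm.trans h2

/-- The cross term `γ ⟪φ, v⟫ ⟪φ', v⟫` is at most `γ / 2` times the sum of the squares, and by
stationarity both squares have the same mean. -/
lemma inner_A_ge (hφ : ∀ s, ‖E.φ s‖ ≤ 1) (v : Vec d) :
    (1 - E.γ) * ⟪v, E.C v⟫_ℝ ≤ ⟪v, E.A v⟫_ℝ := by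
  have hm := E.measurable_feature_diff
  have hsq : ∀ s, ⟪E.φ s, v⟫_ℝ ^ 2 ≤ ‖v‖ ^ 2 := fun s =>
    sq_le_sq' (neg_le_of_abs_le (abs_inner_feature_le hφ s v))
      (le_of_abs_le (abs_inner_feature_le hφ s v))
  have i1 : Integrable (fun x : S × S => ⟪E.φ x.1, v⟫_ℝ ^ 2) E.sampleLaw :=
    integrable_of_norm_le ((measurable_inner_fst v).pow_const 2) (‖v‖ ^ 2) fun x => by
      rw [Real.norm_of_nonneg (sq_nonneg _)]; exact hsq _
  have i2 : Integrable (fun x : S × S => ⟪E.φ x.2, v⟫_ℝ ^ 2) E.sampleLaw :=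
    integrable_of_norm_le ((measurable_inner_snd v).pow_const 2) (‖v‖ ^ 2) fun x => by
      rw [Real.norm_of_nonneg (sq_nonneg _)]; exact hsq _
  have hint := integrable_inner_smul (E := E) hm E.measurable_φ_fst (norm_feature_diff_le hφ)
    (fun x => hφ x.1) v
  rw [inner_C hφ, A_apply hφ, ← integral_inner hint]
  calc (1 - E.γ) * ∫ x, ⟪E.φ x.1, v⟫_ℝ ^ 2 ∂E.sampleLaw
      = ∫ x, ((1 - E.γ / 2) * ⟪E.φ x.1, v⟫_ℝ ^ 2 - (E.γ / 2) * ⟪E.φ x.2, v⟫_ℝ ^ 2)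
          ∂E.sampleLaw := by
        rw [integral_sub (i1.const_mul _) (i2.const_mul _), integral_const_mul, integral_const_mul,
          integral_inner_snd_sq]
        ring
    _ ≤ _ := by
        refine integral_mono ((i1.const_mul _).sub (i2.const_mul _))
          (hint.const_inner v) fun x => ?_
        simp only [inner_smul_right, inner_sub_left, inner_smul_left, conj_trivial]
        rw [real_inner_comm (E.φ x.1) v]
        -- The difference of the two sides is `γ / 2` times this square.
        nlinarith [mul_nonneg E.γ_nonneg (sq_nonneg (⟪E.φ x.1, v⟫_ℝ - ⟪E.φ x.2, v⟫_ℝ))]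

lemma exists_coercive_C (hφ : ∀ s, ‖E.φ s‖ ≤ 1) (hΦ : E.FullRank) :
    ∃ m : ℝ, 0 < m ∧ Coercive m E.C := by
  refine exists_coercive fun v hv => ?_
  rw [inner_C hφ]
  have i1 : Integrable (fun x : S × S => ⟪E.φ x.1, v⟫_ℝ ^ 2) E.sampleLaw :=
    integrable_of_norm_le ((measurable_inner_fst v).pow_const 2) (‖v‖ ^ 2) fun x => by
      rw [Real.norm_of_nonneg (sq_nonneg _)]
      exact sq_le_sq' (neg_le_of_abs_le (abs_inner_feature_le hφ _ v))
        (le_of_abs_le (abs_inner_feature_le hφ _ v))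
  refine lt_of_le_of_ne (integral_nonneg fun x => sq_nonneg _) fun h0 => hv (hΦ v ?_)
  have h1 := (integral_eq_zero_iff_of_nonneg (fun x => sq_nonneg _) i1).mp h0.symm
  rw [← E.sampleLaw_map_fst, ae_map_iff measurable_fst.aemeasurable]
  · filter_upwards [h1] with x hx
    simpa using hx
  · exact (E.φ_meas.inner_const) (measurableSet_singleton 0)

lemma exists_coercive_A (hφ : ∀ s, ‖E.φ s‖ ≤ 1) (hΦ : E.FullRank) :
    ∃ m : ℝ, 0 < m ∧ Coercive m E.A := by
  obtain ⟨m, hm, hC⟩ := exists_coercive_C hφ hΦ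
  have hγ := sub_pos.mpr E.γ_lt_one
  refine ⟨(1 - E.γ) * m, mul_pos hγ hm, fun x => (le_trans ?_ (inner_A_ge hφ x))⟩
  rw [mul_assoc]
  exact mul_le_mul_of_nonneg_left (hC x) hγ.le

end PolicyEval

/-! ### The three algorithms as two-timescale samplings. -/

namespace Algorithm

variable {S Act : Type*} [MeasurableSpace S] [MeasurableSpace Act] {d : ℕ}
variable {E : PolicyEval S Act d}

/-- In each case `X₁` reduces to `Aᵀ W₂⁻¹ A`; for TDC this is `A - (C - Aᵀ) C⁻¹ A = Aᵀ C⁻¹ A`. -/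
lemma exists_coercive_drift (hφ : ∀ s, ‖E.φ s‖ ≤ 1) (hΦ : E.FullRank) (alg : Algorithm) :
    ∃ m : ℝ, 0 < m ∧ m ≤ 1 ∧ Coercive m (alg.drift E).X₁ ∧ Coercive m (alg.drift E).W₂ := by
  obtain ⟨c, hc, hC⟩ := PolicyEval.exists_coercive_C hφ hΦ
  obtain ⟨a, ha, hA⟩ := PolicyEval.exists_coercive_A hφ hΦ
  have hI : Coercive 1 (ContinuousLinearMap.id ℝ (Vec d)) := fun x => by simp
  have key : ∃ m₁ m₂ : ℝ, 0 < m₁ ∧ 0 < m₂ ∧ Coercive m₁ (alg.drift E).X₁ ∧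
      Coercive m₂ (alg.drift E).W₂ := by
    cases alg with
    | GTD0 =>
      obtain ⟨m, hm, h⟩ := exists_coercive_congruence ha one_pos hA hI
      refine ⟨m, 1, hm, one_pos, ?_, hI⟩
      convert h using 1
      simp [drift, TwoTimescale.X₁]
    | GTD2 =>
      obtain ⟨m, hm, h⟩ := exists_coercive_congruence ha hc hA hC
      refine ⟨m, c, hm, hc, ?_, hC⟩
      convert h using 1
      simp [drift, TwoTimescale.X₁]
    | TDC =>
      obtain ⟨m, hm, h⟩ := exists_coercive_congruence ha hc hA hC
      refine ⟨m, c, hm, hc, ?_, hC⟩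
      convert h using 1
      ext1 x
      have := (hC.isInvertible hc).self_apply_inverse (E.A x)
      simp [drift, TwoTimescale.X₁, this]
  obtain ⟨m₁, m₂, h₁, h₂, hX, hW⟩ := key
  refine ⟨min 1 (min m₁ m₂), by positivity, min_le_left _ _, hX.mono ?_, hW.mono ?_⟩
  · exact (min_le_right _ _).trans (min_le_left _ _)
  · exact (min_le_right _ _).trans (min_le_right _ _)

lemma measurable_tdError :
    Measurable fun q : (Vec d × Vec d) × (S × S) => E.tdError q.2 q.1.1 := by
  have h1 := E.measurable_φ_fst
  have h2 := E.measurable_φ_snd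
  have h3 := E.measurable_r_fst
  unfold PolicyEval.tdError
  exact ((h3.comp measurable_snd).add ((measurable_fst.fst.inner
    (h2.comp measurable_snd)).const_mul _)).sub (measurable_fst.fst.inner (h1.comp measurable_snd))

lemma abs_tdError_le (hr : ∀ s, |E.r s| ≤ 1) (hφ : ∀ s, ‖E.φ s‖ ≤ 1) (x : S × S) (θ : Vec d) :
    |E.tdError x θ| ≤ 1 + 2 * ‖θ‖ := by
  have h1 := PolicyEval.abs_inner_feature_le hφ x.1 θ
  have h2 := PolicyEval.abs_inner_feature_le hφ x.2 θ
  have h3 := hr x.1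
  rw [real_inner_comm] at h1 h2
  have h4 : |E.γ * ⟪θ, E.φ x.2⟫_ℝ| ≤ ‖θ‖ := by
    rw [abs_mul, abs_of_nonneg E.γ_nonneg]
    nlinarith [E.γ_nonneg, E.γ_lt_one, abs_nonneg ⟪θ, E.φ x.2⟫_ℝ]
  unfold PolicyEval.tdError
  rw [abs_le] at *
  constructor <;> linarith [h1.1, h1.2, h3.1, h3.2, h4.1, h4.2]

lemma integral_tdError_smul (hr : ∀ s, |E.r s| ≤ 1) (hφ : ∀ s, ‖E.φ s‖ ≤ 1) (θ : Vec d) :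
    ∫ x, E.tdError x θ • E.φ x.1 ∂E.sampleLaw = E.b - E.A θ := by
  have hm := E.measurable_feature_diff
  rw [PolicyEval.A_apply hφ, PolicyEval.b, ← integral_sub]
  · refine integral_congr_ae (Filter.Eventually.of_forall fun x => ?_)
    simp only [PolicyEval.tdError]
    rw [← sub_smul, inner_sub_left, inner_smul_left, real_inner_comm (E.φ x.1),
      real_inner_comm (E.φ x.2)]
    congr 1
    simp
    ring
  · refine PolicyEval.integrable_of_norm_le (E.measurable_r_fst.smul E.measurable_φ_fst) 1
      fun x => ?_
    rw [norm_smul]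
    exact mul_le_one₀ (hr _) (norm_nonneg _) (hφ _)
  · exact PolicyEval.integrable_inner_smul hm E.measurable_φ_fst
      (PolicyEval.norm_feature_diff_le hφ) (fun x => hφ x.1) θ

lemma integrable_tdError_smul (hr : ∀ s, |E.r s| ≤ 1) (hφ : ∀ s, ‖E.φ s‖ ≤ 1) (θ : Vec d) :
    Integrable (fun x => E.tdError x θ • E.φ x.1) E.sampleLaw := by
  refine PolicyEval.integrable_of_norm_le
    (((measurable_tdError (E := E)).comp (measurable_const.prodMk measurable_id)
      (f := fun x => ((θ, θ), x))).smul E.measurable_φ_fst) ((1 + 2 * ‖θ‖) * 1) fun x => ?_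
  rw [norm_smul]
  gcongr
  · exact abs_tdError_le hr hφ x θ
  · exact hφ _

lemma norm_tdError_smul_le (hr : ∀ s, |E.r s| ≤ 1) (hφ : ∀ s, ‖E.φ s‖ ≤ 1) (x : S × S)
    (θ : Vec d) : ‖E.tdError x θ • E.φ x.1‖ ≤ 1 + 2 * ‖θ‖ := by
  rw [norm_smul]
  exact (mul_le_of_le_one_right (norm_nonneg _) (hφ _)).trans (abs_tdError_le hr hφ x θ)

lemma norm_inner_smul_le (hφ : ∀ s, ‖E.φ s‖ ≤ 1) (s : S) (w u : Vec d) {c : ℝ} (hu : ‖u‖ ≤ c) :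
    ‖⟪E.φ s, w⟫_ℝ • u‖ ≤ ‖w‖ * c := by
  rw [norm_smul]
  exact mul_le_mul (PolicyEval.abs_inner_feature_le hφ s w) hu (norm_nonneg _) (norm_nonneg _)

lemma isSampling (hr : ∀ s, |E.r s| ≤ 1) (hφ : ∀ s, ‖E.φ s‖ ≤ 1) (alg : Algorithm) :
    IsSampling (alg.drift E) E.sampleLaw (alg.slowDir E) (alg.fastDir E) := by
  have mφ : Measurable fun q : (Vec d × Vec d) × (S × S) => E.φ q.2.1 :=
    E.measurable_φ_fst.comp measurable_snd
  have mφ' : Measurable fun q : (Vec d × Vec d) × (S × S) => E.φ q.2.2 :=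
    E.measurable_φ_snd.comp measurable_snd
  have mδ := measurable_tdError (E := E)
  have mw : Measurable fun q : (Vec d × Vec d) × (S × S) => q.1.2 := measurable_fst.snd
  have mi : Measurable fun q : (Vec d × Vec d) × (S × S) => ⟪E.φ q.2.1, q.1.2⟫_ℝ := mφ.inner mw
  have iC := fun w => PolicyEval.integrable_inner_smul (E := E) E.measurable_φ_fst
    E.measurable_φ_fst (fun x => hφ x.1) (fun x => hφ x.1) w
  have hm := E.measurable_feature_diff
  have iA := fun w => PolicyEval.integrable_inner_smul (E := E) E.measurable_φ_fst
    hm (fun x => hφ x.1) (PolicyEval.norm_feature_diff_le hφ) w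
  have iδ := integrable_tdError_smul (E := E) hr hφ
  have hbδ := norm_tdError_smul_le (E := E) hr hφ
  have hd := PolicyEval.norm_feature_diff_le (E := E) hφ
  cases alg with
  | GTD0 =>
    refine ⟨mi.smul (mφ.sub (mφ'.const_smul E.γ)), (mδ.smul mφ).sub mw, fun θ w => ?_,
      fun θ w => ?_, fun x θ w => ?_, fun x θ w => ?_⟩
    · simp [slowDir, drift, TwoTimescale.h₁, PolicyEval.adjoint_A_apply hφ]
    · simp only [fastDir, drift, TwoTimescale.h₂]
      rw [integral_sub (iδ θ) (integrable_const _), integral_tdError_smul hr hφ]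
      simp
    · refine (norm_inner_smul_le hφ x.1 w _ (hd x)).trans ?_
      nlinarith [norm_nonneg θ, norm_nonneg w]
    · refine (norm_sub_le _ _).trans ?_
      nlinarith [norm_nonneg θ, norm_nonneg w, hbδ x θ]
  | GTD2 =>
    refine ⟨mi.smul (mφ.sub (mφ'.const_smul E.γ)), (mδ.smul mφ).sub (mi.smul mφ), fun θ w => ?_,
      fun θ w => ?_, fun x θ w => ?_, fun x θ w => ?_⟩
    · simp [slowDir, drift, TwoTimescale.h₁, PolicyEval.adjoint_A_apply hφ]
    · simp only [fastDir, drift, TwoTimescale.h₂]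
      rw [integral_sub (iδ θ) (iC w), integral_tdError_smul hr hφ, PolicyEval.C_apply hφ]
    · refine (norm_inner_smul_le hφ x.1 w _ (hd x)).trans ?_
      nlinarith [norm_nonneg θ, norm_nonneg w]
    · refine (norm_sub_le _ _).trans ?_
      nlinarith [norm_nonneg θ, norm_nonneg w, hbδ x θ,
        norm_inner_smul_le hφ x.1 w _ (hφ x.1)]
  | TDC =>
    -- This splitting displays the mean of the TDC correction as `C w - Aᵀ w`.
    have e : ∀ (x : S × S) (w : Vec d), (E.γ * ⟪E.φ x.1, w⟫_ℝ) • E.φ x.2 =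
        ⟪E.φ x.1, w⟫_ℝ • E.φ x.1 - ⟪E.φ x.1, w⟫_ℝ • (E.φ x.1 - E.γ • E.φ x.2) := fun x w => by
      rw [smul_sub, sub_sub_cancel, smul_smul, mul_comm]
    refine ⟨(mδ.smul mφ).sub ((mi.const_mul _).smul mφ'), (mδ.smul mφ).sub (mi.smul mφ),
      fun θ w => ?_, fun θ w => ?_, fun x θ w => ?_, fun x θ w => ?_⟩
    · simp only [slowDir, drift, TwoTimescale.h₁, e]
      rw [integral_sub (iδ θ) (by exact (iC w).sub (iA w)), integral_sub (iC w) (iA w),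
        integral_tdError_smul hr hφ, sub_apply, PolicyEval.C_apply hφ,
        PolicyEval.adjoint_A_apply hφ]
    · simp only [fastDir, drift, TwoTimescale.h₂]
      rw [integral_sub (iδ θ) (iC w), integral_tdError_smul hr hφ, PolicyEval.C_apply hφ]
    · refine (norm_sub_le _ _).trans ?_
      have h1 : ‖(E.γ * ⟪E.φ x.1, w⟫_ℝ) • E.φ x.2‖ ≤ ‖w‖ := by
        rw [mul_smul, norm_smul, Real.norm_of_nonneg E.γ_nonneg]
        have := norm_inner_smul_le hφ x.1 w _ (hφ x.2)
        nlinarith [E.γ_nonneg, E.γ_lt_one, norm_nonneg (⟪E.φ x.1, w⟫_ℝ • E.φ x.2)]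
      nlinarith [norm_nonneg θ, norm_nonneg w, hbδ x θ]
    · refine (norm_sub_le _ _).trans ?_
      nlinarith [norm_nonneg θ, norm_nonneg w, hbδ x θ,
        norm_inner_smul_le hφ x.1 w _ (hφ x.1)]

end Algorithm

/-! ### One-step drift of exponential moments. -/

section ExponentialStep

variable {𝒳 : Type*} [MeasurableSpace 𝒳] {ℓ : Measure 𝒳} [IsProbabilityMeasure ℓ]

/-- Hoeffding's lemma for a bounded variable that need not be centred. -/
lemma lintegral_exp_le_of_bounded {Y : 𝒳 → ℝ} (hY : Measurable Y) {σ m : ℝ}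
    (hσ : ∀ ξ, |Y ξ| ≤ σ) (hm : ∫ ξ, Y ξ ∂ℓ = m) (t : ℝ) :
    ∫⁻ ξ, ENNReal.ofReal (Real.exp (t * Y ξ)) ∂ℓ ≤
      ENNReal.ofReal (Real.exp (t * m + t ^ 2 * σ ^ 2 / 2)) := by
  have hmem : ∀ᵐ ξ ∂ℓ, Y ξ ∈ Set.Icc (-σ) σ :=
    Filter.Eventually.of_forall fun ξ => abs_le.mp (hσ ξ)
  have hint : Integrable (fun ξ => Real.exp (t * Y ξ)) ℓ :=
    integrable_exp_mul_of_mem_Icc hY.aemeasurable hmem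
  rw [← ofReal_integral_eq_lintegral_ofReal hint
    (Filter.Eventually.of_forall fun ξ => (Real.exp_pos _).le)]
  refine ENNReal.ofReal_le_ofReal ?_
  have h := (hasSubgaussianMGF_of_mem_Icc hY.aemeasurable hmem).mgf_le t
  rw [hm] at h
  have h1 : ∫ ξ, Real.exp (t * Y ξ) ∂ℓ = Real.exp (t * m) * mgf (fun ξ => Y ξ - m) ℓ t := by
    rw [mgf, ← integral_const_mul]
    refine integral_congr_ae (Filter.Eventually.of_forall fun ξ => ?_)
    simp only
    rw [← Real.exp_add]
    congr 1
    ring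
  rw [h1, Real.exp_add]
  refine mul_le_mul_of_nonneg_left (h.trans_eq ?_) (Real.exp_pos _).le
  congr 1
  push_cast
  have : (‖σ - -σ‖ / 2) ^ 2 = σ ^ 2 := by
    rw [Real.norm_eq_abs, div_pow, sq_abs]; ring
  rw [this]
  ring

/-- One step of a stochastic Lyapunov argument for the exponential moment of `s V / ε`, where the
noise level `ε` itself decreases to `ε'`. -/
lemma lyapunov_exp_step {V' Y : 𝒳 → ℝ} {v v₀ m σ s ε ε' c a C : ℝ}
    (hV : ∀ ξ, V' ξ ≤ v₀ + Y ξ) (hY : Measurable Y) (hσ : ∀ ξ, |Y ξ| ≤ σ)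
    (hm : ∫ ξ, Y ξ ∂ℓ = m) (hdrift : v₀ + m ≤ (1 - c * a) * v + C * a * ε)
    (hvar : σ ^ 2 ≤ C * a * ε * v) (hv : 0 ≤ v) (hε : 0 < ε) (hε' : 0 < ε')
    (ha : 0 ≤ a) (hc : 0 ≤ c) (hca : c * a ≤ 1) (hC : 0 ≤ C) (hs : 0 < s) (hsC : s * C ≤ c / 2)
    (hr : ε / ε' ≤ 1 + c * a / 4) :
    ∫⁻ ξ, ENNReal.ofReal (Real.exp (s / ε' * V' ξ)) ∂ℓ ≤
      ENNReal.ofReal (Real.exp ((1 - c * a / 4) * (s / ε * v) + 4 * s * C * a)) := by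
  set t := s / ε' with ht
  have ht0 : 0 < t := div_pos hs hε'
  have hca0 : 0 ≤ c * a := mul_nonneg hc ha
  calc ∫⁻ ξ, ENNReal.ofReal (Real.exp (t * V' ξ)) ∂ℓ
      ≤ ∫⁻ ξ, ENNReal.ofReal (Real.exp (t * v₀)) * ENNReal.ofReal (Real.exp (t * Y ξ)) ∂ℓ := by
        refine lintegral_mono fun ξ => ?_
        rw [← ENNReal.ofReal_mul (Real.exp_pos _).le, ← Real.exp_add]
        refine ENNReal.ofReal_le_ofReal (Real.exp_le_exp.mpr ?_)
        rw [← mul_add]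
        exact mul_le_mul_of_nonneg_left (hV ξ) ht0.le
    _ = ENNReal.ofReal (Real.exp (t * v₀)) * ∫⁻ ξ, ENNReal.ofReal (Real.exp (t * Y ξ)) ∂ℓ := by
        rw [lintegral_const_mul]
        fun_prop
    _ ≤ ENNReal.ofReal (Real.exp (t * v₀)) *
          ENNReal.ofReal (Real.exp (t * m + t ^ 2 * σ ^ 2 / 2)) := by
        gcongr
        exact lintegral_exp_le_of_bounded hY hσ hm t
    _ ≤ _ := by
        rw [← ENNReal.ofReal_mul (Real.exp_pos _).le, ← Real.exp_add]
        refine ENNReal.ofReal_le_ofReal (Real.exp_le_exp.mpr ?_)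
        set r := ε / ε' with hr_def
        have hr0 : 0 < r := div_pos hε hε'
        have hr2 : r ≤ 2 := by linarith
        have htr : t = s / ε * r := by rw [ht, hr_def]; field_simp
        set y := s / ε * v with hy
        have hy0 : 0 ≤ y := by positivity
        have e1 : t * v₀ + t * m ≤ r * ((1 - c * a) * y + s * C * a) := by
          calc t * v₀ + t * m = t * (v₀ + m) := by ring
            _ ≤ t * ((1 - c * a) * v + C * a * ε) := by gcongr
            _ = r * ((1 - c * a) * y + s * C * a) := by
              rw [htr, hy]; field_simp
        -- The Hoeffding term is linear in `v` because `σ²` is, and `s * C ≤ c / 2` makes it cost at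
        -- most half of the contraction.
        have e2 : t ^ 2 * σ ^ 2 / 2 ≤ r * (c / 2 * a * y) := by
          calc t ^ 2 * σ ^ 2 / 2 ≤ t ^ 2 * (C * a * ε * v) / 2 := by gcongr
            _ = r * (r * (s * C) * a * y / 2) := by rw [htr, hy]; field_simp
            _ ≤ r * (2 * (c / 2) * a * y / 2) := by
              gcongr
            _ = _ := by ring
        -- Half of what is left pays for passing from the scale `ε` to `ε'`.
        have e3 : r * (1 - c * a / 2) ≤ 1 - c * a / 4 := by
          calc r * (1 - c * a / 2) ≤ (1 + c * a / 4) * (1 - c * a / 2) := by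
                gcongr; linarith
            _ ≤ 1 - c * a / 4 := by nlinarith
        have e4 : r * (1 - c * a / 2) * y ≤ (1 - c * a / 4) * y := by gcongr
        have e5 : r * (s * C * a) ≤ 2 * (s * C * a) := by gcongr
        have e6 : 0 ≤ s * C * a := by positivity
        nlinarith

end ExponentialStep

/-! ### One step of the fast and of the weighted Lyapunov function. -/

section Step

variable {d : ℕ} {𝒳 : Type*} [MeasurableSpace 𝒳] {ℓ : Measure 𝒳} [IsProbabilityMeasure ℓ]

lemma norm_add_sq_le {d : ℕ} (x y : Vec d) {b : ℝ} (hb : ‖y‖ ≤ b) :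
    ‖x + y‖ ^ 2 ≤ ‖x‖ ^ 2 + b ^ 2 + 2 * ⟪x, y⟫_ℝ := by
  rw [norm_add_sq_real]
  have : ‖y‖ ^ 2 ≤ b ^ 2 := by gcongr
  linarith

lemma norm_fast_increment_le {d : ℕ} {g₁ g₂ : Vec d} {D : Mat d} {H α β : ℝ}
    (hg : ‖g₂‖ + ‖D g₁‖ ≤ H) (hα : 0 ≤ α) (hαβ : α ≤ β) : ‖β • g₂ + α • D g₁‖ ≤ β * H := by
  have hβ := hα.trans hαβ
  calc _ ≤ ‖β • g₂‖ + ‖α • D g₁‖ := norm_add_le _ _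
    _ = β * ‖g₂‖ + α * ‖D g₁‖ := by
      rw [norm_smul, norm_smul, Real.norm_of_nonneg hα, Real.norm_of_nonneg hβ]
    _ ≤ β * ‖g₂‖ + β * ‖D g₁‖ := by gcongr
    _ = β * (‖g₂‖ + ‖D g₁‖) := by ring
    _ ≤ _ := by gcongr

lemma integrable_of_norm_bound {f : 𝒳 → Vec d} (hf : Measurable f) {H : ℝ}
    (h : ∀ ξ, ‖f ξ‖ ≤ H) : Integrable f ℓ :=
  Integrable.of_bound hf.aestronglyMeasurable H (Filter.Eventually.of_forall h)

lemma norm_mean_le {f : 𝒳 → Vec d} {H : ℝ} (h : ∀ ξ, ‖f ξ‖ ≤ H) : ‖∫ ξ, f ξ ∂ℓ‖ ≤ H := by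
  simpa using norm_integral_le_of_norm_le_const (μ := ℓ) (Filter.Eventually.of_forall h)

variable {x z : Vec d} {G₁ G₂ : 𝒳 → Vec d} {X W W₂ D : Mat d} {H m k ω α β s ε' : ℝ}

lemma integral_inner_fast (m₁ : Measurable G₁) (m₂ : Measurable G₂) (hG₁ : ∀ ξ, ‖G₁ ξ‖ ≤ H)
    (hG₂ : ∀ ξ, ‖G₂ ξ‖ + ‖D (G₁ ξ)‖ ≤ H) (hmean₂ : ∫ ξ, G₂ ξ ∂ℓ = -W₂ z) :
    ∫ ξ, ⟪z, β • G₂ ξ + α • D (G₁ ξ)⟫_ℝ ∂ℓ =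
      -β * ⟪z, W₂ z⟫_ℝ + α * ⟪z, ∫ ξ, D (G₁ ξ) ∂ℓ⟫_ℝ := by
  have i2 : Integrable G₂ ℓ := integrable_of_norm_bound m₂ (H := H) fun ξ => by
    have := hG₂ ξ
    linarith [norm_nonneg (D (G₁ ξ))]
  have i1 : Integrable (fun ξ => D (G₁ ξ)) ℓ := D.integrable_comp (integrable_of_norm_bound m₁ hG₁)
  have i2' : Integrable (fun ξ => β • G₂ ξ) ℓ := i2.smul β
  have i1' : Integrable (fun ξ => α • D (G₁ ξ)) ℓ := i1.smul α
  have hi : Integrable (fun ξ => β • G₂ ξ + α • D (G₁ ξ)) ℓ := i2'.add i1'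
  rw [integral_inner hi, integral_add i2' i1', integral_smul, integral_smul, hmean₂, inner_add_right,
    inner_smul_right, inner_smul_right, inner_neg_right]
  ring

/-- This is `lyapunov_exp_step` at noise level `β` and rate `β`. The factor `k + 1` is not needed
for this function; it allows the same `s` and the same constant as in `exp_step_slow`. -/
lemma exp_step_fast (m₁ : Measurable G₁) (m₂ : Measurable G₂) (hG₁ : ∀ ξ, ‖G₁ ξ‖ ≤ H)
    (hG₂ : ∀ ξ, ‖G₂ ξ‖ + ‖D (G₁ ξ)‖ ≤ H) (hmean₂ : ∫ ξ, G₂ ξ ∂ℓ = -W₂ z)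
    (hW₂ : Coercive m W₂) (hm : 0 < m) (hm1 : m ≤ 1) (hk : 0 ≤ k)
    (hα : 0 < α) (hαβ : α ≤ β) (hβ1 : β ≤ 1) (hrel : α ^ 2 = β ^ 3) (hε' : 0 < ε')
    (hr : β / ε' ≤ 1 + m / 8 * α) (hs : 0 < s) (hsC : s * (20 * (k + 1) * (H ^ 2 / m)) ≤ m / 4) :
    ∫⁻ ξ, ENNReal.ofReal (Real.exp (s / ε' * ‖z + (β • G₂ ξ + α • D (G₁ ξ))‖ ^ 2)) ∂ℓ ≤
      ENNReal.ofReal (Real.exp ((1 - m / 8 * β) * (s / β * ‖z‖ ^ 2) +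
        4 * s * (20 * (k + 1) * (H ^ 2 / m)) * β)) := by
  have hβ : 0 < β := hα.trans_le hαβ
  obtain ⟨ξ₀⟩ := nonempty_of_isProbabilityMeasure ℓ
  have hH : 0 ≤ H := (norm_nonneg _).trans (hG₁ ξ₀)
  set q := H ^ 2 / m with hq
  have hq0 : 0 ≤ q := by positivity
  have hHq : H ^ 2 = m * q := by rw [hq]; field_simp
  have hHq' : H ^ 2 ≤ q := by rw [hHq]; exact mul_le_of_le_one_left hq0 hm1
  have hinc := fun ξ => norm_fast_increment_le (hG₂ ξ) hα.le hαβ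
  have hDh : ‖∫ ξ, D (G₁ ξ) ∂ℓ‖ ≤ H := norm_mean_le fun ξ => by
    have := hG₂ ξ
    linarith [norm_nonneg (G₂ ξ)]
  have hstep := lyapunov_exp_step (ℓ := ℓ) (V' := fun ξ => ‖z + (β • G₂ ξ + α • D (G₁ ξ))‖ ^ 2)
    (Y := fun ξ => 2 * ⟪z, β • G₂ ξ + α • D (G₁ ξ)⟫_ℝ) (v := ‖z‖ ^ 2)
    (v₀ := ‖z‖ ^ 2 + (β * H) ^ 2)
    (m := 2 * (-β * ⟪z, W₂ z⟫_ℝ + α * ⟪z, ∫ ξ, D (G₁ ξ) ∂ℓ⟫_ℝ)) (σ := 2 * (‖z‖ * (β * H))) (s := s)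
    (ε := β) (ε' := ε') (c := m / 2) (a := β) (C := 20 * (k + 1) * q)
    (fun ξ => norm_add_sq_le _ _ (hinc ξ)) ?_ ?_ ?_ ?_ ?_ (sq_nonneg _) hβ hε' hβ.le
    (by positivity) ?_ (by positivity) hs (by linarith) ?_
  · convert hstep using 6; ring
  · have : Measurable fun ξ => β • G₂ ξ + α • D (G₁ ξ) :=
      (m₂.const_smul β).add ((D.continuous.measurable.comp m₁).const_smul α)
    exact (Measurable.const_inner this).const_mul 2
  · intro ξ
    rw [abs_mul, abs_two]
    gcongr
    exact (abs_real_inner_le_norm _ _).trans (by gcongr; exact hinc ξ)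
  · rw [integral_const_mul, integral_inner_fast m₁ m₂ hG₁ hG₂ hmean₂]
  · have h1 := hW₂ z
    have h2 : ⟪z, ∫ ξ, D (G₁ ξ) ∂ℓ⟫_ℝ ≤ ‖z‖ * H :=
      (real_inner_le_norm _ _).trans (by gcongr)
    set ζ := ‖z‖
    -- Young's inequality for the motion of `λ(θ)`: half of the dissipation is spent, and the
    -- remainder `α² H² / (β m)` equals `β² q` because `α² = β³`.
    have h3 : 2 * (α * (ζ * H)) ≤ β * m * ζ ^ 2 + β ^ 2 * q := by
      have e : β * m * (β * m * ζ ^ 2 + β ^ 2 * q - 2 * (α * (ζ * H))) =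
          (β * m * ζ - α * H) ^ 2 := by
        have : β * m * (β ^ 2 * q) = α ^ 2 * H ^ 2 := by rw [hrel, hHq]; ring
        linear_combination this
      have hpos : 0 < β * m := by positivity
      have : 0 ≤ β * m * ζ ^ 2 + β ^ 2 * q - 2 * (α * (ζ * H)) := by
        refine nonneg_of_mul_nonneg_right (b := _) ?_ hpos
        rw [e]
        exact sq_nonneg _
      linarith
    have h4 : β * (m * ζ ^ 2) ≤ β * ⟪z, W₂ z⟫_ℝ := by gcongr
    have h5 : α * ⟪z, ∫ ξ, D (G₁ ξ) ∂ℓ⟫_ℝ ≤ α * (ζ * H) := by gcongr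
    have h6 : (β * H) ^ 2 ≤ β ^ 2 * q := by rw [mul_pow]; gcongr
    have h7 : 2 * (β ^ 2 * q) ≤ 20 * (k + 1) * q * β * β := by
      nlinarith [mul_nonneg hk (mul_nonneg (sq_nonneg β) hq0), mul_nonneg (sq_nonneg β) hq0]
    have h8 : 0 ≤ β * m * ζ ^ 2 := by positivity
    nlinarith
  · have : (2 * (‖z‖ * (β * H))) ^ 2 = 4 * (β * β * ‖z‖ ^ 2) * H ^ 2 := by ring
    rw [this]
    calc 4 * (β * β * ‖z‖ ^ 2) * H ^ 2 ≤ 4 * (β * β * ‖z‖ ^ 2) * q := by gcongr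
      _ ≤ 20 * (k + 1) * (β * β * ‖z‖ ^ 2) * q := by gcongr; linarith
      _ = _ := by ring
  · nlinarith
  · have : m / 8 * α ≤ m / 8 * β := by gcongr
    linarith

/-- Young's inequality for the coupling of the slow to the fast error; it fixes how large `k` has to
be. -/
lemma two_mul_mul_le_of_sq_le {u ζ : ℝ} (hm : 0 < m) (hk : 2 * ω ^ 2 ≤ k * m ^ 2) :
    2 * (u * (ω * ζ)) ≤ m * u ^ 2 + m * k / 2 * ζ ^ 2 := by
  refine le_of_mul_le_mul_left ?_ hm
  linarith [sq_nonneg (m * u - ω * ζ), mul_le_mul_of_nonneg_right hk (sq_nonneg ζ)]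

/-- Since `(α/β) β = α`, the weighted fast part dissipates `k α m ζ²`. One half of the dissipation
left after tracking absorbs the coupling and the other half remains as contraction. The squared
increments have order `α β`, which is the rate `α` times the level `β`. -/
lemma exp_step_slow (m₁ : Measurable G₁) (m₂ : Measurable G₂) (hG₁ : ∀ ξ, ‖G₁ ξ‖ ≤ H)
    (hG₂ : ∀ ξ, ‖G₂ ξ‖ + ‖D (G₁ ξ)‖ ≤ H) (hmean₂ : ∫ ξ, G₂ ξ ∂ℓ = -W₂ z)
    (hmean₁ : ∫ ξ, G₁ ξ ∂ℓ = -X x - W z) (hX : Coercive m X) (hω : ‖W‖ ≤ ω)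
    (hW₂ : Coercive m W₂) (hm : 0 < m) (hm1 : m ≤ 1) (hkω : 2 * ω ^ 2 / m ^ 2 ≤ k) (hk : 0 < k)
    (hα : 0 < α) (hαβ : α ≤ β) (hβ1 : β ≤ 1) (hrel : α ^ 2 = β ^ 3) (hε' : 0 < ε')
    {ρ' : ℝ} (hρ' : ρ' ≤ α / β)
    (hr : β / ε' ≤ 1 + m / 8 * α) (hs : 0 < s) (hsC : s * (20 * (k + 1) * (H ^ 2 / m)) ≤ m / 4) :
    ∫⁻ ξ, ENNReal.ofReal (Real.exp (s / ε' * (‖x + α • G₁ ξ‖ ^ 2 +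
        k * ρ' * ‖z + (β • G₂ ξ + α • D (G₁ ξ))‖ ^ 2))) ∂ℓ ≤
      ENNReal.ofReal (Real.exp ((1 - m / 8 * α) *
        (s / β * (‖x‖ ^ 2 + k * (α / β) * ‖z‖ ^ 2)) +
        4 * s * (20 * (k + 1) * (H ^ 2 / m)) * α)) := by
  have hβ : 0 < β := hα.trans_le hαβ
  obtain ⟨ξ₀⟩ := nonempty_of_isProbabilityMeasure ℓ
  have hH : 0 ≤ H := (norm_nonneg _).trans (hG₁ ξ₀)
  have hω0 : 0 ≤ ω := (norm_nonneg _).trans hω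
  set q := H ^ 2 / m with hq
  have hq0 : 0 ≤ q := by positivity
  have hHq : H ^ 2 = m * q := by rw [hq]; field_simp
  have hHq' : H ^ 2 ≤ q := by rw [hHq]; exact mul_le_of_le_one_left hq0 hm1
  set ρ := α / β with hρ
  have hρ0 : 0 < ρ := by positivity
  have hρ1 : ρ ≤ 1 := (div_le_one hβ).mpr hαβ
  have hαρ : α = ρ * β := by rw [hρ]; field_simp
  -- The relation `α² = β³`, in terms of the ratio `ρ`.
  have hβρ : β = ρ ^ 2 := by
    have : (ρ * β) ^ 2 = β ^ 3 := by rw [← hαρ]; exact hrel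
    have h2 : β ^ 2 * (ρ ^ 2 - β) = 0 := by linear_combination this
    rcases mul_eq_zero.mp h2 with h | h
    · exact absurd h (by positivity)
    · linarith
  have hinc := fun ξ => norm_fast_increment_le (hG₂ ξ) hα.le hαβ
  have hinc₁ : ∀ ξ, ‖α • G₁ ξ‖ ≤ α * H := fun ξ => by
    rw [norm_smul, Real.norm_of_nonneg hα.le]; gcongr; exact hG₁ ξ
  have hDh : ‖∫ ξ, D (G₁ ξ) ∂ℓ‖ ≤ H := norm_mean_le fun ξ => by
    have := hG₂ ξ
    linarith [norm_nonneg (G₂ ξ)]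
  have mf : Measurable fun ξ => β • G₂ ξ + α • D (G₁ ξ) :=
    (m₂.const_smul β).add ((D.continuous.measurable.comp m₁).const_smul α)
  have ms : Measurable fun ξ => α • G₁ ξ := m₁.const_smul α
  have hstep := lyapunov_exp_step (ℓ := ℓ)
    (V' := fun ξ => ‖x + α • G₁ ξ‖ ^ 2 + k * ρ' * ‖z + (β • G₂ ξ + α • D (G₁ ξ))‖ ^ 2)
    (Y := fun ξ => 2 * ⟪x, α • G₁ ξ⟫_ℝ + k * ρ * (2 * ⟪z, β • G₂ ξ + α • D (G₁ ξ)⟫_ℝ))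
    (v := ‖x‖ ^ 2 + k * ρ * ‖z‖ ^ 2)
    (v₀ := ‖x‖ ^ 2 + (α * H) ^ 2 + k * ρ * (‖z‖ ^ 2 + (β * H) ^ 2))
    (m := 2 * (α * (-⟪x, X x⟫_ℝ - ⟪x, W z⟫_ℝ)) +
      k * ρ * (2 * (-β * ⟪z, W₂ z⟫_ℝ + α * ⟪z, ∫ ξ, D (G₁ ξ) ∂ℓ⟫_ℝ)))
    (σ := 2 * (‖x‖ * (α * H)) + k * ρ * (2 * (‖z‖ * (β * H)))) (s := s)
    (ε := β) (ε' := ε') (c := m / 2) (a := α) (C := 20 * (k + 1) * q)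
    ?_ ?_ ?_ ?_ ?_ ?_ (by positivity) hβ hε' hα.le
    (by positivity) ?_ (by positivity) hs (by linarith) (by linarith)
  · convert hstep using 6; ring
  · intro ξ
    have e1 := norm_add_sq_le x _ (hinc₁ ξ)
    have e2 := norm_add_sq_le z _ (hinc ξ)
    have e3 : k * ρ' * ‖z + (β • G₂ ξ + α • D (G₁ ξ))‖ ^ 2 ≤
        k * ρ * ‖z + (β • G₂ ξ + α • D (G₁ ξ))‖ ^ 2 := by gcongr
    have e4 := mul_le_mul_of_nonneg_left e2 (mul_pos hk hρ0).le
    linarith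
  · exact ((Measurable.const_inner ms).const_mul 2).add
      (((Measurable.const_inner mf).const_mul 2).const_mul _)
  · intro ξ
    have e1 : |⟪x, α • G₁ ξ⟫_ℝ| ≤ ‖x‖ * (α * H) :=
      (abs_real_inner_le_norm _ _).trans (by gcongr; exact hinc₁ ξ)
    have e2 : |⟪z, β • G₂ ξ + α • D (G₁ ξ)⟫_ℝ| ≤ ‖z‖ * (β * H) :=
      (abs_real_inner_le_norm _ _).trans (by gcongr; exact hinc ξ)
    refine (abs_add_le _ _).trans ?_
    rw [abs_mul, abs_two, abs_mul (k * ρ), abs_mul 2, abs_two, abs_of_pos (mul_pos hk hρ0)]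
    gcongr
  · have i1 : Integrable (fun ξ => α • G₁ ξ) ℓ := integrable_of_norm_bound ms hinc₁
    have i2 : Integrable (fun ξ => β • G₂ ξ + α • D (G₁ ξ)) ℓ := integrable_of_norm_bound mf hinc
    rw [integral_add ((i1.const_inner x).const_mul 2) (((i2.const_inner z).const_mul 2).const_mul _),
      integral_const_mul, integral_const_mul, integral_const_mul,
      integral_inner_fast m₁ m₂ hG₁ hG₂ hmean₂, integral_inner i1, integral_smul, hmean₁,
      inner_smul_right, inner_sub_right, inner_neg_right]
  · have h1 := hX x
    have h1' := hW₂ z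
    have h2 : ⟪z, ∫ ξ, D (G₁ ξ) ∂ℓ⟫_ℝ ≤ ‖z‖ * H :=
      (real_inner_le_norm _ _).trans (by gcongr)
    have h2' : -⟪x, W z⟫_ℝ ≤ ‖x‖ * (ω * ‖z‖) := by
      refine (neg_le_abs _).trans ((abs_real_inner_le_norm _ _).trans ?_)
      gcongr
      exact (W.le_opNorm z).trans (by gcongr)
    have hζ := norm_nonneg z
    have hu := norm_nonneg x
    set ζ := ‖z‖
    set u := ‖x‖
    have h3 : 2 * (ρ * (ζ * H)) ≤ m * ζ ^ 2 + ρ ^ 2 * q := by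
      refine le_of_mul_le_mul_left ?_ hm
      have e : m * (m * ζ ^ 2 + ρ ^ 2 * q) - m * (2 * (ρ * (ζ * H))) = (m * ζ - ρ * H) ^ 2 := by
        linear_combination (-ρ ^ 2) * hHq
      linarith [sq_nonneg (m * ζ - ρ * H)]
    have h4 : 2 * (u * (ω * ζ)) ≤ m * u ^ 2 + m * k / 2 * ζ ^ 2 :=
      two_mul_mul_le_of_sq_le hm (by rwa [div_le_iff₀ (by positivity)] at hkω)
    have t1 : α * (-⟪x, X x⟫_ℝ - ⟪x, W z⟫_ℝ) ≤ α * (-(m * u ^ 2) + u * (ω * ζ)) := by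
      gcongr
      linarith
    have t2 : -β * ⟪z, W₂ z⟫_ℝ + α * ⟪z, ∫ ξ, D (G₁ ξ) ∂ℓ⟫_ℝ ≤
        β * (-(m * ζ ^ 2) + ρ * (ζ * H)) := by
      have e1 : β * (m * ζ ^ 2) ≤ β * ⟪z, W₂ z⟫_ℝ := by gcongr
      have e2 : α * ⟪z, ∫ ξ, D (G₁ ξ) ∂ℓ⟫_ℝ ≤ α * (ζ * H) := by gcongr
      have e3 : α * (ζ * H) = β * (ρ * (ζ * H)) := by rw [hαρ]; ring
      linarith
    have t3 : 2 * (α * (-⟪x, X x⟫_ℝ - ⟪x, W z⟫_ℝ)) ≤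
        α * (-(m * u ^ 2) + m * k / 2 * ζ ^ 2) := by
      have := mul_le_mul_of_nonneg_left h4 hα.le
      linarith
    have t4 : k * ρ * (2 * (-β * ⟪z, W₂ z⟫_ℝ + α * ⟪z, ∫ ξ, D (G₁ ξ) ∂ℓ⟫_ℝ)) ≤
        k * α * (-(m * ζ ^ 2) + β * q) := by
      calc _ ≤ k * ρ * (2 * (β * (-(m * ζ ^ 2) + ρ * (ζ * H)))) := by gcongr
        _ = k * α * (-(2 * (m * ζ ^ 2)) + 2 * (ρ * (ζ * H))) := by rw [hαρ]; ring
        _ ≤ k * α * (-(2 * (m * ζ ^ 2)) + (m * ζ ^ 2 + ρ ^ 2 * q)) := by gcongr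
        _ = _ := by rw [← hβρ]; ring
    have t5 : (α * H) ^ 2 ≤ α * β * q := by
      calc (α * H) ^ 2 = α * α * H ^ 2 := by ring
        _ ≤ α * β * q := by gcongr
    have t6 : k * ρ * (β * H) ^ 2 ≤ k * α * β * q := by
      calc k * ρ * (β * H) ^ 2 = k * α * β * H ^ 2 := by rw [hαρ]; ring
        _ ≤ _ := by gcongr
    have t7 : m / 2 * α * (u ^ 2 + k * ρ * ζ ^ 2) ≤ m / 2 * α * (u ^ 2 + k * 1 * ζ ^ 2) := by
      gcongr
    have t8 : 0 ≤ m * α * u ^ 2 := by positivity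
    have t9 : 0 ≤ k * (α * β * q) := by positivity
    have t10 : 0 ≤ α * β * q := by positivity
    linarith
  -- Both parts of the noise carry the factor `α H`, as `ρ β = α`; one factor `α = ρ β` of the
  -- square then restores the weight `ρ` of `‖z‖²`.
  · have e0 : (2 * (‖x‖ * (α * H)) + k * ρ * (2 * (‖z‖ * (β * H)))) ^ 2 ≤
        8 * (α ^ 2 * H ^ 2) * (‖x‖ ^ 2 + k ^ 2 * ‖z‖ ^ 2) := by
      have : 2 * (‖x‖ * (α * H)) + k * ρ * (2 * (‖z‖ * (β * H))) =
          2 * (α * H) * (‖x‖ + k * ‖z‖) := by rw [hαρ]; ring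
      rw [this]
      have h2 : (‖x‖ + k * ‖z‖) ^ 2 ≤ 2 * (‖x‖ ^ 2 + k ^ 2 * ‖z‖ ^ 2) := by
        nlinarith [sq_nonneg (‖x‖ - k * ‖z‖)]
      calc _ = 4 * (α ^ 2 * H ^ 2) * (‖x‖ + k * ‖z‖) ^ 2 := by ring
        _ ≤ 4 * (α ^ 2 * H ^ 2) * (2 * (‖x‖ ^ 2 + k ^ 2 * ‖z‖ ^ 2)) := by gcongr
        _ = _ := by ring
    refine e0.trans ?_
    have e1 : α ^ 2 * H ^ 2 * ‖x‖ ^ 2 ≤ α * β * q * ‖x‖ ^ 2 := by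
      rw [sq α]; gcongr
    have e2 : α ^ 2 * H ^ 2 * (k ^ 2 * ‖z‖ ^ 2) ≤ α * β * q * (k * (k * ρ * ‖z‖ ^ 2)) := by
      calc α ^ 2 * H ^ 2 * (k ^ 2 * ‖z‖ ^ 2) = α * β * H ^ 2 * (k * (k * ρ * ‖z‖ ^ 2)) := by
            rw [hαρ]; ring
        _ ≤ _ := by gcongr
    have e3 : 0 ≤ α * β * q * ‖x‖ ^ 2 := by positivity
    have e4 : 0 ≤ α * β * q * (k * ρ * ‖z‖ ^ 2) := by positivity
    linarith [mul_nonneg hk.le e3, mul_nonneg hk.le e4]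
  · nlinarith

end Step

/-- Convexity of `exp` between `u` and `0`; it turns a contracted exponent into a convex combination
of moments. -/
lemma exp_convex_le {u e : ℝ} (h0 : 0 ≤ e) (h1 : e ≤ 1) :
    Real.exp ((1 - e) * u) ≤ (1 - e) * Real.exp u + e := by
  have := convexOn_exp.2 (Set.mem_univ u) (Set.mem_univ 0) (sub_nonneg.mpr h1) h0 (by ring)
  simpa using this

/-! ### Following the chain until it leaves the good set. -/

section Alive

variable {Ω 𝒳 P : Type*}

/-- The event that every step `F i (p i) (X i)`, `n₀ ≤ i < j`, ends in the good set. -/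
def alive (F : ℕ → P → 𝒳 → P) (X : ℕ → Ω → 𝒳) (p : ℕ → Ω → P) (Good : ℕ → Set P) (n₀ j : ℕ) :
    Set Ω := {ω | ∀ i, n₀ ≤ i → i < j → F i (p i ω) (X i ω) ∈ Good (i + 1)}

variable {X : ℕ → Ω → 𝒳} {p : ℕ → Ω → P} {F : ℕ → P → 𝒳 → P}
  {Good : ℕ → Set P} {n₀ n₁ : ℕ}

lemma alive_anti {i j : ℕ} (hij : i ≤ j) : alive F X p Good n₀ j ⊆ alive F X p Good n₀ i :=
  fun _ hω k h1 h2 => hω k h1 (h2.trans_le hij)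

lemma alive_succ {j : ℕ} (hj : n₀ ≤ j) : alive F X p Good n₀ (j + 1) =
    alive F X p Good n₀ j ∩ {ω | F j (p j ω) (X j ω) ∈ Good (j + 1)} := by
  ext ω
  constructor
  · exact fun h => ⟨alive_anti (Nat.le_succ j) h, h j hj (Nat.lt_succ_self j)⟩
  · rintro ⟨h1, h2⟩ i hi hij
    rcases Nat.lt_succ_iff_lt_or_eq.mp hij with h | rfl
    · exact h1 i hi h
    · exact h2

lemma mem_good_of_alive (hinit : ∀ ω, p n₀ ω ∈ Good n₀)
    (hstep : ∀ j, n₀ ≤ j → j + 1 < n₁ → ∀ ω, F j (p j ω) (X j ω) ∈ Good (j + 1) →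
      p (j + 1) ω = F j (p j ω) (X j ω))
    {j : ℕ} (hj : n₀ ≤ j) (hj1 : j < n₁) {ω : Ω} (hω : ω ∈ alive F X p Good n₀ j) :
    p j ω ∈ Good j := by
  rcases hj.eq_or_lt with rfl | hlt
  · exact hinit ω
  · obtain ⟨i, rfl⟩ : ∃ i, j = i + 1 := ⟨j - 1, by omega⟩
    have h1 := hω i (by omega) (by omega)
    rw [hstep i (by omega) hj1 ω h1]
    exact h1

/-- Union bound over the time of the first exit. -/
lemma measure_compl_alive_le {mΩ : MeasurableSpace Ω} {μ : Measure Ω} {n : ℕ} (hn : n₀ ≤ n) :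
    μ (alive F X p Good n₀ n)ᶜ ≤ ∑ j ∈ Finset.Ico n₀ n,
      μ (alive F X p Good n₀ j ∩ {ω | F j (p j ω) (X j ω) ∉ Good (j + 1)}) := by
  induction n, hn using Nat.le_induction with
  | base =>
    have : alive F X p Good n₀ n₀ = Set.univ := by
      ext ω; simp only [alive, Set.mem_univ, iff_true]
      intro i h1 h2; omega
    simp [this]
  | succ j hj ih =>
    rw [Finset.sum_Ico_succ_top hj]
    have : (alive F X p Good n₀ (j + 1))ᶜ ⊆ (alive F X p Good n₀ j)ᶜ ∪
        (alive F X p Good n₀ j ∩ {ω | F j (p j ω) (X j ω) ∉ Good (j + 1)}) := by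
      rw [alive_succ hj]
      intro ω hω
      by_cases h : ω ∈ alive F X p Good n₀ j
      · exact Or.inr ⟨h, fun h2 => hω ⟨h, h2⟩⟩
      · exact Or.inl h
    exact (measure_mono this).trans ((measure_union_le _ _).trans (by gcongr))

end Alive

/-- Fubini for a variable `Y` known at time `ℱ` and an independent sample `X`. -/
lemma setLIntegral_indep {Ω 𝒳 P : Type*} {ℱ mΩ : MeasurableSpace Ω}
    [MeasurableSpace 𝒳] [MeasurableSpace P] {μ : Measure Ω} [IsProbabilityMeasure μ]
    {ℓ : Measure 𝒳} [IsProbabilityMeasure ℓ] (hℱ : ℱ ≤ mΩ) {Y : Ω → P} {X : Ω → 𝒳}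
    (hY : Measurable[ℱ] Y) (hX : Measurable X) (hlaw : μ.map X = ℓ)
    (hind : Indep ℱ (MeasurableSpace.comap X inferInstance) μ) {A : Set Ω}
    (hA : MeasurableSet[ℱ] A) {f : P × 𝒳 → ENNReal} (hf : Measurable f) :
    ∫⁻ ω in A, f (Y ω, X ω) ∂μ = ∫⁻ ω in A, ∫⁻ ξ, f (Y ω, ξ) ∂ℓ ∂μ := by
  have hY' : Measurable Y := hY.mono hℱ le_rfl
  have hprod : ((μ.restrict A).map Y).prod ℓ = (μ.restrict A).map fun ω => (Y ω, X ω) := by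
    refine Measure.prod_eq fun s t hs ht => ?_
    rw [Measure.map_apply (hY'.prodMk hX) (hs.prod ht), Measure.map_apply hY' hs, ← hlaw,
      Measure.map_apply hX ht, Measure.restrict_apply ((hY'.prodMk hX) (hs.prod ht)),
      Measure.restrict_apply (hY' hs)]
    have h := (Indep_iff _ _ μ).mp hind (Y ⁻¹' s ∩ A) (X ⁻¹' t)
      (MeasurableSet.inter (hY hs) hA) ⟨t, ht, rfl⟩
    rw [← h]
    congr 1
    ext ω
    simp only [Set.mem_inter_iff, Set.mem_preimage, Set.mem_prod]
    tauto
  have h1 := lintegral_map (μ := μ.restrict A) hf (hY'.prodMk hX)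
  rw [← h1, ← hprod, lintegral_prod _ hf.aemeasurable, lintegral_map hf.lintegral_prod_right' hY']

/-! ### Propagation of exponential moments on the surviving event. -/

section Chain

variable {Ω 𝒳 P : Type*} {mΩ : MeasurableSpace Ω} [MeasurableSpace 𝒳] [MeasurableSpace P]
  {μ : Measure Ω} {ℓ : Measure 𝒳}

/-- `p` is adapted to `ℱ`, and `X n` is a fresh sample with law `ℓ` at time `n`. -/
structure IsAdaptedChain (μ : Measure Ω) (ℓ : Measure 𝒳) (ℱ : Filtration ℕ mΩ) (X : ℕ → Ω → 𝒳)
    (p : ℕ → Ω → P) : Prop where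
  meas_p : ∀ n, Measurable[ℱ n] (p n)
  meas_X : ∀ n, Measurable[ℱ (n + 1)] (X n)
  indep : ∀ n, Indep (ℱ n) (MeasurableSpace.comap (X n) inferInstance) μ
  law : ∀ n, μ.map (X n) = ℓ

variable {ℱ : Filtration ℕ mΩ} {X : ℕ → Ω → 𝒳} {p : ℕ → Ω → P} {F : ℕ → P → 𝒳 → P}
  {Good : ℕ → Set P} {n₀ n₁ : ℕ}

lemma measurableSet_alive (h : IsAdaptedChain μ ℓ ℱ X p)
    (hF : ∀ n, Measurable fun q : P × 𝒳 => F n q.1 q.2) (hG : ∀ n, MeasurableSet (Good n)) (j : ℕ) :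
    MeasurableSet[ℱ j] (alive F X p Good n₀ j) := by
  have : alive F X p Good n₀ j =
      ⋂ i, ⋂ (_ : n₀ ≤ i), ⋂ (_ : i < j), {ω | F i (p i ω) (X i ω) ∈ Good (i + 1)} := by
    ext ω; simp [alive]
  rw [this]
  refine MeasurableSet.iInter fun i => MeasurableSet.iInter fun _ => MeasurableSet.iInter
    fun hij => ?_
  have hp : Measurable[ℱ j] (p i) := (h.meas_p i).mono (ℱ.mono hij.le) le_rfl
  have hX : Measurable[ℱ j] (X i) := (h.meas_X i).mono (ℱ.mono hij) le_rfl
  have hm : Measurable[ℱ j] fun ω => F i (p i ω) (X i ω) := (hF i).comp (hp.prodMk hX)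
  exact hm (hG (i + 1))

/-- The bound for the logarithm of the exponential moment that a drift condition with rates `η`
and level `K` propagates from the initial value `y₀`. -/
noncomputable def logMoment (K y₀ : ℝ) (η : ℕ → ℝ) (n₀ j : ℕ) : ℝ :=
  K + y₀ * ∏ i ∈ Finset.Ico n₀ j, (1 - η i)

lemma logMoment_succ {K y₀ : ℝ} {η : ℕ → ℝ} {j : ℕ} (hj : n₀ ≤ j) :
    logMoment K y₀ η n₀ (j + 1) = (1 - η j) * logMoment K y₀ η n₀ j + K * η j := by
  rw [logMoment, logMoment, Finset.prod_Ico_succ_top hj]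
  ring

variable [IsProbabilityMeasure μ] [IsProbabilityMeasure ℓ] {W : ℕ → P → ℝ} {η : ℕ → ℝ} {K y₀ : ℝ}

/-- Centring by `logMoment` cancels `K * η j` exactly, so the conditional moment of the next step is
at most `exp ((1 - η) u)`, with `u` the current centred exponent. By convexity the bound `1`
reproduces itself. The integral is over survival up to `j` only, an event independent of the sample
`X j`. -/
lemma setLIntegral_exp_step_le (h : IsAdaptedChain μ ℓ ℱ X p)
    (hF : ∀ n, Measurable fun q : P × 𝒳 => F n q.1 q.2) (hG : ∀ n, MeasurableSet (Good n))
    (hW : ∀ n, Measurable (W n)) (hη0 : ∀ n, 0 ≤ η n) (hη1 : ∀ n, η n ≤ 1) {j : ℕ} (hj : n₀ ≤ j)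
    (hdrift : ∀ q ∈ Good j, ∫⁻ ξ, ENNReal.ofReal (Real.exp (W (j + 1) (F j q ξ))) ∂ℓ ≤
      ENNReal.ofReal (Real.exp ((1 - η j) * W j q + K * η j)))
    (hgood : ∀ ω ∈ alive F X p Good n₀ j, p j ω ∈ Good j)
    (hcur : ∫⁻ ω in alive F X p Good n₀ j,
      ENNReal.ofReal (Real.exp (W j (p j ω) - logMoment K y₀ η n₀ j)) ∂μ ≤ 1) :
    ∫⁻ ω in alive F X p Good n₀ j, ENNReal.ofReal (Real.exp
      (W (j + 1) (F j (p j ω) (X j ω)) - logMoment K y₀ η n₀ (j + 1))) ∂μ ≤ 1 := by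
  set Y := logMoment K y₀ η n₀
  set A := alive F X p Good n₀ j with hA
  have hAm : MeasurableSet[ℱ j] A := measurableSet_alive h hF hG j
  have hX : Measurable (X j) := (h.meas_X j).mono (ℱ.le _) le_rfl
  have hp : Measurable (p j) := (h.meas_p j).mono (ℱ.le _) le_rfl
  have hfm : Measurable fun q : P × 𝒳 =>
      ENNReal.ofReal (Real.exp (W (j + 1) (F j q.1 q.2) - Y (j + 1))) :=
    (Real.measurable_exp.comp (((hW (j + 1)).comp (hF j)).sub_const _)).ennreal_ofReal
  rw [setLIntegral_indep (ℱ.le j) (h.meas_p j) hX (h.law j) (h.indep j) hAm hfm]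
  calc ∫⁻ ω in A, ∫⁻ ξ, ENNReal.ofReal (Real.exp (W (j + 1) (F j (p j ω) ξ) - Y (j + 1))) ∂ℓ ∂μ
      ≤ ∫⁻ ω in A, (ENNReal.ofReal (1 - η j) *
          ENNReal.ofReal (Real.exp (W j (p j ω) - Y j)) + ENNReal.ofReal (η j)) ∂μ := by
        refine setLIntegral_mono' (ℱ.le j _ hAm) fun ω hω => ?_
        have e1 : ∀ ξ, ENNReal.ofReal (Real.exp (W (j + 1) (F j (p j ω) ξ) - Y (j + 1))) =
            ENNReal.ofReal (Real.exp (-Y (j + 1))) *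
              ENNReal.ofReal (Real.exp (W (j + 1) (F j (p j ω) ξ))) := fun ξ => by
          rw [← ENNReal.ofReal_mul (Real.exp_pos _).le, ← Real.exp_add]
          congr 2; ring
        simp_rw [e1]
        have hmm : Measurable fun ξ => ENNReal.ofReal (Real.exp (W (j + 1) (F j (p j ω) ξ))) :=
          (Real.measurable_exp.comp ((hW (j + 1)).comp ((hF j).comp
            measurable_prodMk_left))).ennreal_ofReal
        rw [lintegral_const_mul _ hmm]
        refine (mul_le_mul_right (hdrift _ (hgood ω hω)) _).trans ?_
        rw [← ENNReal.ofReal_mul (Real.exp_pos _).le, ← Real.exp_add,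
          ← ENNReal.ofReal_mul (sub_nonneg.mpr (hη1 j)),
          ← ENNReal.ofReal_add (mul_nonneg (sub_nonneg.mpr (hη1 j)) (Real.exp_pos _).le) (hη0 j)]
        refine ENNReal.ofReal_le_ofReal ?_
        refine le_trans (le_of_eq ?_) (exp_convex_le (hη0 j) (hη1 j))
        congr 1
        rw [show Y (j + 1) = (1 - η j) * Y j + K * η j from logMoment_succ hj]
        ring
    _ ≤ ENNReal.ofReal (1 - η j) * 1 + ENNReal.ofReal (η j) * 1 := by
        have hmm : Measurable fun ω => ENNReal.ofReal (Real.exp (W j (p j ω) - Y j)) :=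
          (Real.measurable_exp.comp (((hW j).comp hp).sub_const _)).ennreal_ofReal
        rw [lintegral_add_right _ measurable_const, lintegral_const_mul _ hmm, setLIntegral_const]
        gcongr
        exact prob_le_one
    _ = 1 := by
        rw [mul_one, mul_one, ← ENNReal.ofReal_add (sub_nonneg.mpr (hη1 j)) (hη0 j)]
        simp

/-- Surviving the next step identifies the unprojected step with the iterate and shrinks the domain
of integration, which closes the induction. -/
lemma setLIntegral_exp_le (h : IsAdaptedChain μ ℓ ℱ X p)
    (hF : ∀ n, Measurable fun q : P × 𝒳 => F n q.1 q.2) (hG : ∀ n, MeasurableSet (Good n))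
    (hinit : ∀ ω, p n₀ ω ∈ Good n₀)
    (hstep : ∀ j, n₀ ≤ j → j + 1 < n₁ → ∀ ω, F j (p j ω) (X j ω) ∈ Good (j + 1) →
      p (j + 1) ω = F j (p j ω) (X j ω))
    (hW : ∀ n, Measurable (W n)) (hη0 : ∀ n, 0 ≤ η n) (hη1 : ∀ n, η n ≤ 1) (hK : 0 ≤ K)
    (hdrift : ∀ j, n₀ ≤ j → j < n₁ → ∀ q ∈ Good j,
      ∫⁻ ξ, ENNReal.ofReal (Real.exp (W (j + 1) (F j q ξ))) ∂ℓ ≤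
        ENNReal.ofReal (Real.exp ((1 - η j) * W j q + K * η j)))
    (hy₀ : ∀ ω, W n₀ (p n₀ ω) ≤ y₀) {j : ℕ} (hj : n₀ ≤ j) (hj1 : j < n₁) :
    ∫⁻ ω in alive F X p Good n₀ j,
      ENNReal.ofReal (Real.exp (W j (p j ω) - logMoment K y₀ η n₀ j)) ∂μ ≤ 1 := by
  induction j, hj using Nat.le_induction with
  | base =>
    calc _ ≤ ∫⁻ ω in alive F X p Good n₀ n₀, 1 ∂μ := by
          refine lintegral_mono fun ω => ?_
          rw [ENNReal.ofReal_le_one, Real.exp_le_one_iff, logMoment]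
          simp only [Finset.Ico_self, Finset.prod_empty]
          linarith [hy₀ ω]
      _ ≤ 1 := by
          rw [setLIntegral_const, one_mul]
          exact prob_le_one
  | succ j hj ih =>
    have hjn : j < n₁ := by omega
    have h1 := setLIntegral_exp_step_le h hF hG hW hη0 hη1 hj (hdrift j hj hjn)
      (fun ω hω => mem_good_of_alive hinit hstep hj hjn hω) (ih hjn)
    refine le_trans ?_ h1
    have hm := ℱ.le _ _ (measurableSet_alive (n₀ := n₀) h hF hG (j + 1))
    calc _ = ∫⁻ ω in alive F X p Good n₀ (j + 1), ENNReal.ofReal (Real.exp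
          (W (j + 1) (F j (p j ω) (X j ω)) - logMoment K y₀ η n₀ (j + 1))) ∂μ := by
          refine setLIntegral_congr_fun hm fun ω hω => ?_
          rw [hstep j hj hj1 ω (hω j hj (Nat.lt_succ_self j))]
      _ ≤ _ := lintegral_mono_set (alive_anti (Nat.le_succ j))

/-- Markov's inequality for the unprojected step. This step need not lie in the good set, so the
bound serves both exits and final deviations. -/
lemma measure_alive_inter_le (h : IsAdaptedChain μ ℓ ℱ X p)
    (hF : ∀ n, Measurable fun q : P × 𝒳 => F n q.1 q.2) (hG : ∀ n, MeasurableSet (Good n))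
    (hinit : ∀ ω, p n₀ ω ∈ Good n₀)
    (hstep : ∀ j, n₀ ≤ j → j + 1 < n₁ → ∀ ω, F j (p j ω) (X j ω) ∈ Good (j + 1) →
      p (j + 1) ω = F j (p j ω) (X j ω))
    (hW : ∀ n, Measurable (W n)) (hη0 : ∀ n, 0 ≤ η n) (hη1 : ∀ n, η n ≤ 1) (hK : 0 ≤ K)
    (hdrift : ∀ j, n₀ ≤ j → j < n₁ → ∀ q ∈ Good j,
      ∫⁻ ξ, ENNReal.ofReal (Real.exp (W (j + 1) (F j q ξ))) ∂ℓ ≤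
        ENNReal.ofReal (Real.exp ((1 - η j) * W j q + K * η j)))
    (hy₀ : ∀ ω, W n₀ (p n₀ ω) ≤ y₀) {j : ℕ} (hj : n₀ ≤ j) (hj1 : j < n₁) (w : ℝ) :
    μ (alive F X p Good n₀ j ∩ {ω | w ≤ W (j + 1) (F j (p j ω) (X j ω))}) ≤
      ENNReal.ofReal (Real.exp (logMoment K y₀ η n₀ (j + 1) - w)) := by
  have h1 := setLIntegral_exp_step_le h hF hG hW hη0 hη1 hj (hdrift j hj hj1)
    (fun ω hω => mem_good_of_alive hinit hstep hj hj1 hω)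
    (setLIntegral_exp_le h hF hG hinit hstep hW hη0 hη1 hK hdrift hy₀ hj hj1)
  set Y := logMoment K y₀ η n₀ (j + 1)
  have hX : Measurable (X j) := (h.meas_X j).mono (ℱ.le _) le_rfl
  have hp : Measurable (p j) := (h.meas_p j).mono (ℱ.le _) le_rfl
  have hWm : Measurable fun ω => W (j + 1) (F j (p j ω) (X j ω)) :=
    (hW (j + 1)).comp ((hF j).comp (hp.prodMk hX))
  have hm := ℱ.le _ _ (measurableSet_alive (n₀ := n₀) h hF hG j)
  have hS : MeasurableSet {ω | w ≤ W (j + 1) (F j (p j ω) (X j ω))} :=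
    measurableSet_le measurable_const hWm
  calc μ (alive F X p Good n₀ j ∩ {ω | w ≤ W (j + 1) (F j (p j ω) (X j ω))})
      = ENNReal.ofReal (Real.exp (Y - w)) *
        ∫⁻ ω in alive F X p Good n₀ j ∩ {ω | w ≤ W (j + 1) (F j (p j ω) (X j ω))},
          ENNReal.ofReal (Real.exp (w - Y)) ∂μ := by
        rw [setLIntegral_const, ← mul_assoc, ← ENNReal.ofReal_mul (Real.exp_pos _).le,
          ← Real.exp_add]
        simp
    _ ≤ ENNReal.ofReal (Real.exp (Y - w)) * 1 := by
        gcongr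
        refine le_trans ?_ h1
        calc _ ≤ ∫⁻ ω in alive F X p Good n₀ j ∩ {ω | w ≤ W (j + 1) (F j (p j ω) (X j ω))},
              ENNReal.ofReal (Real.exp (W (j + 1) (F j (p j ω) (X j ω)) - Y)) ∂μ := by
              refine setLIntegral_mono' (hm.inter hS) fun ω hω => ?_
              have : w ≤ W (j + 1) (F j (p j ω) (X j ω)) := hω.2
              gcongr
          _ ≤ _ := lintegral_mono_set Set.inter_subset_left
    _ = _ := mul_one _

end Chain

/-! ### A run as an adapted chain. -/

section Run

variable {Ω A B C : Type*} {mΩ : MeasurableSpace Ω} [MeasurableSpace A] [MeasurableSpace B]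
  [MeasurableSpace C] {μ : Measure Ω}

/-- The two hypotheses make the joint law of the triple a product of three laws; reassociating the
product gives the claim. -/
lemma indepFun_prodMk_of_indepFun [IsProbabilityMeasure μ] {f : Ω → A} {g : Ω → B} {k : Ω → C} (hf : Measurable f)
    (hg : Measurable g) (hk : Measurable k) (hgk : IndepFun g k μ)
    (hf_gk : IndepFun f (fun ω => (g ω, k ω)) μ) : IndepFun (fun ω => (f ω, g ω)) k μ := by
  have hfg : IndepFun f g μ := hf_gk.comp (φ := id) (ψ := Prod.fst) measurable_id measurable_fst
  rw [indepFun_iff_map_prod_eq_prod_map_map hf.aemeasurable (hg.prodMk hk).aemeasurable,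
    (indepFun_iff_map_prod_eq_prod_map_map hg.aemeasurable hk.aemeasurable).mp hgk] at hf_gk
  rw [indepFun_iff_map_prod_eq_prod_map_map (hf.prodMk hg).aemeasurable hk.aemeasurable,
    (indepFun_iff_map_prod_eq_prod_map_map hf.aemeasurable hg.aemeasurable).mp hfg]
  have : IsProbabilityMeasure (μ.map f) := Measure.isProbabilityMeasure_map hf.aemeasurable
  have : IsProbabilityMeasure (μ.map g) := Measure.isProbabilityMeasure_map hg.aemeasurable
  have : IsProbabilityMeasure (μ.map k) := Measure.isProbabilityMeasure_map hk.aemeasurable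
  have h1 : (μ.map fun ω => (f ω, (g ω, k ω))).map MeasurableEquiv.prodAssoc.symm =
      μ.map fun ω => ((f ω, g ω), k ω) :=
    Measure.map_map MeasurableEquiv.prodAssoc.symm.measurable (hf.prodMk (hg.prodMk hk))
  rw [← h1, hf_gk]
  exact (MeasurePreserving.symm _ (measurePreserving_prodAssoc _ _ _)).map_eq

variable {S Act : Type*} [MeasurableSpace S] [MeasurableSpace Act] {d : ℕ}
  {E : PolicyEval S Act d} {X : ℕ → Ω → S × S} {θ₀ w₀ : Ω → Vec d}

/-- Initial values and samples before time `n`. -/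
def history (X : ℕ → Ω → S × S) (θ₀ w₀ : Ω → Vec d) (n : ℕ) (ω : Ω) :
    (Vec d × Vec d) × (Finset.range n → S × S) := ((θ₀ ω, w₀ ω), fun i => X i ω)

lemma measurable_history (h : IsRun E μ X θ₀ w₀) (n : ℕ) : Measurable (history X θ₀ w₀ n) :=
  (h.θ₀_meas.prodMk h.w₀_meas).prodMk (measurable_pi_lambda _ fun i => h.X_meas i)

lemma indepFun_history [IsProbabilityMeasure μ] (h : IsRun E μ X θ₀ w₀) (n : ℕ) :
    IndepFun (history X θ₀ w₀ n) (X n) μ := by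
  refine indepFun_prodMk_of_indepFun (h.θ₀_meas.prodMk h.w₀_meas)
    (measurable_pi_lambda _ fun i => h.X_meas i) (h.X_meas n) ?_ ?_
  · have h1 := h.indep.indepFun_finset (Finset.range n) {n} (by simp) h.X_meas
    exact h1.comp (φ := id) (ψ := fun v => v ⟨n, Finset.mem_singleton_self n⟩) measurable_id
      (measurable_pi_apply (X := fun _ : ({n} : Finset ℕ) => S × S) _)
  · exact h.indep_init.comp (φ := id)
      (ψ := fun v : ℕ → S × S => ((fun i : Finset.range n => v i), v n)) measurable_id
      ((measurable_pi_lambda _ fun i => measurable_pi_apply _).prodMk (measurable_pi_apply _))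

/-- The filtration generated by the initial values and the samples. -/
def IsRun.filtration (h : IsRun E μ X θ₀ w₀) : Filtration ℕ mΩ where
  seq n := MeasurableSpace.comap (history X θ₀ w₀ n) inferInstance
  mono' m n hmn := by
    rw [← measurable_iff_comap_le]
    have : history X θ₀ w₀ m = (fun v : (Vec d × Vec d) × (Finset.range n → S × S) =>
        (v.1, fun i : Finset.range m => v.2 ⟨i, Finset.range_mono hmn i.2⟩)) ∘
        history X θ₀ w₀ n := rfl
    rw [this]
    refine Measurable.comp ?_ (comap_measurable _)
    exact measurable_fst.prodMk (measurable_pi_lambda _ fun i =>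
      (measurable_pi_apply _).comp measurable_snd)
  le' n := (measurable_history h n).comap_le

lemma measurable_ballProj {d : ℕ} (R : ℝ) : Measurable (ballProj (d := d) R) := by
  unfold ballProj
  refine Measurable.ite (measurableSet_le measurable_norm measurable_const) measurable_id ?_
  exact (measurable_const.div measurable_norm).smul measurable_id

lemma measurable_sparseProj {d : ℕ} (n : ℕ) (R : ℝ) : Measurable (sparseProj (d := d) n R) := by
  by_cases h : ∃ k : ℕ, n = 2 ^ k
  · have : sparseProj (d := d) n R = ballProj R := by
      ext1 x; simp only [sparseProj, if_pos h]
    rw [this]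
    exact measurable_ballProj R
  · have : sparseProj (d := d) n R = id := by
      ext1 x; simp only [sparseProj, if_neg h, id]
    rw [this]
    exact measurable_id

/-- The step of the algorithm without projection. -/
noncomputable def freeStep {𝒳 : Type*} (g₁ g₂ : 𝒳 → Vec d → Vec d → Vec d) (α β : ℕ → ℝ) (n : ℕ)
    (p : Vec d × Vec d) (ξ : 𝒳) : Vec d × Vec d :=
  (p.1 + α n • g₁ ξ p.1 p.2, p.2 + β n • g₂ ξ p.1 p.2)

lemma measurable_freeStep {𝒳 : Type*} [MeasurableSpace 𝒳] {T : TwoTimescale d} {ℓ : Measure 𝒳}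
    {g₁ g₂ : 𝒳 → Vec d → Vec d → Vec d} (hg : IsSampling T ℓ g₁ g₂) (α β : ℕ → ℝ) (n : ℕ) :
    Measurable fun q : (Vec d × Vec d) × 𝒳 => freeStep g₁ g₂ α β n q.1 q.2 :=
  (measurable_fst.fst.add (hg.meas₁.const_smul (α n))).prodMk
    (measurable_fst.snd.add (hg.meas₂.const_smul (β n)))

lemma IsRun.isAdaptedChain [IsProbabilityMeasure μ] (h : IsRun E μ X θ₀ w₀) {alg : Algorithm}
    (hg : IsSampling (alg.drift E) E.sampleLaw (alg.slowDir E) (alg.fastDir E)) (α β : ℕ → ℝ)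
    (R₁ R₂ : ℝ) :
    IsAdaptedChain μ E.sampleLaw h.filtration X fun n ω =>
      alg.iter E α β R₁ R₂ (fun k => X k ω) (θ₀ ω) (w₀ ω) n := by
  have hX : ∀ n, Measurable[h.filtration (n + 1)] (X n) := fun n => by
    have : X n = (fun v : (Vec d × Vec d) × (Finset.range (n + 1) → S × S) =>
        v.2 ⟨n, Finset.self_mem_range_succ n⟩) ∘ history X θ₀ w₀ (n + 1) := rfl
    rw [this]
    exact Measurable.comp ((measurable_pi_apply _).comp measurable_snd) (comap_measurable _)
  refine ⟨fun n => ?_, hX, fun n => indepFun_history h n, h.law⟩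
  induction n with
  | zero =>
    exact Measurable.comp (f := history X θ₀ w₀ 0) (g := Prod.fst) measurable_fst
      (comap_measurable _)
  | succ n ih =>
    have ih' := ih.mono (h.filtration.mono (Nat.le_succ n)) le_rfl
    have hs := (measurable_freeStep hg α β n).comp (ih'.prodMk (hX n))
    exact ((measurable_sparseProj (n + 1) (R₁ / 2)).comp (measurable_fst.comp hs)).prodMk
      ((measurable_sparseProj (n + 1) (R₂ / 2)).comp (measurable_snd.comp hs))

end Run

/-! ### Forgetting the initial value. -/

section LogMoment

variable {K y₀ a : ℝ} {η : ℕ → ℝ} {n₀ j : ℕ}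

lemma logMoment_le (hη0 : ∀ n, 0 ≤ η n) (hη1 : ∀ n, η n ≤ 1) (hy₀ : 0 ≤ y₀) :
    logMoment K y₀ η n₀ j ≤ K + y₀ := by
  unfold logMoment
  gcongr
  refine mul_le_of_le_one_right hy₀ (Finset.prod_le_one (fun i _ => sub_nonneg.mpr (hη1 i))
    fun i _ => by linarith [hη0 i])

/-- Only the `n₀` factors with index in `[n₀, 2 n₀)` are kept, each at most `exp (-a)`. -/
lemma logMoment_le_of_two_mul_le (hη0 : ∀ n, 0 ≤ η n) (hη1 : ∀ n, η n ≤ 1) (hy₀ : 0 ≤ y₀)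
    (ha : ∀ i < 2 * n₀, a ≤ η i) (hj : 2 * n₀ ≤ j) :
    logMoment K y₀ η n₀ j ≤ K + y₀ * Real.exp (-(a * n₀)) := by
  unfold logMoment
  gcongr
  calc ∏ i ∈ Finset.Ico n₀ j, (1 - η i) ≤ ∏ i ∈ Finset.Ico n₀ (2 * n₀), (1 - η i) := by
        rw [← Finset.prod_Ico_consecutive _ (by omega : n₀ ≤ 2 * n₀) hj]
        exact mul_le_of_le_one_right (Finset.prod_nonneg fun i _ => sub_nonneg.mpr (hη1 i))
          (Finset.prod_le_one (fun i _ => sub_nonneg.mpr (hη1 i)) fun i _ => by linarith [hη0 i])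
    _ ≤ ∏ i ∈ Finset.Ico n₀ (2 * n₀), Real.exp (-a) := by
        refine Finset.prod_le_prod (fun i _ => sub_nonneg.mpr (hη1 i)) fun i hi => ?_
        have h1 := ha i (Finset.mem_Ico.mp hi).2
        have h2 := Real.add_one_le_exp (-a)
        linarith
    _ = Real.exp (-(a * n₀)) := by
        rw [Finset.prod_const, Nat.card_Ico, ← Real.exp_nat_mul, show 2 * n₀ - n₀ = n₀ by omega]
        congr 1; ring

end LogMoment

/-- Stepsizes `α ≤ β` with `α² = β³`, decreasing together with their ratio. -/
structure StepSizes (α β : ℕ → ℝ) : Prop where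
  pos : ∀ n, 0 < α n
  le : ∀ n, α n ≤ β n
  le_one : ∀ n, β n ≤ 1
  rel : ∀ n, α n ^ 2 = β n ^ 3
  anti_slow : Antitone α
  anti_fast : Antitone β
  anti_ratio : ∀ n, α (n + 1) / β (n + 1) ≤ α n / β n

lemma StepSizes.pos_fast {α β : ℕ → ℝ} (h : StepSizes α β) (n : ℕ) : 0 < β n :=
  (h.pos n).trans_le (h.le n)

/-! ### Lyapunov functions of the two timescales. -/

namespace TwoTimescale

variable {d : ℕ} (T : TwoTimescale d)

/-- Squared distance of the fast variable from its equilibrium. -/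
noncomputable def fastLyap (p : Vec d × Vec d) : ℝ := ‖p.2 - T.lam p.1‖ ^ 2

/-- Squared distance of the slow variable from its equilibrium, plus a multiple of `fastLyap`. -/
noncomputable def slowLyap (k : ℝ) (α β : ℕ → ℝ) (n : ℕ) (p : Vec d × Vec d) : ℝ :=
  ‖p.1 - T.θstar‖ ^ 2 + k * (α n / β n) * T.fastLyap p

/-- The box on which the errors of both variables are bounded. -/
def box (b₁ b₂ : ℝ) : Set (Vec d × Vec d) := {p | ‖p.1 - T.θstar‖ ^ 2 ≤ b₁ ∧ T.fastLyap p ≤ b₂}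

variable {T}

lemma fastLyap_nonneg (p : Vec d × Vec d) : 0 ≤ T.fastLyap p := sq_nonneg _

lemma measurable_fastLyap : Measurable T.fastLyap := by
  have h := T.continuous_lam
  unfold fastLyap
  exact Continuous.measurable (by fun_prop)

lemma measurable_slowLyap (k : ℝ) (α β : ℕ → ℝ) (n : ℕ) : Measurable (T.slowLyap k α β n) := by
  have h : Measurable fun p : Vec d × Vec d => ‖p.1 - T.θstar‖ ^ 2 :=
    Continuous.measurable (by fun_prop)
  exact h.add (measurable_fastLyap.const_mul _)

lemma measurableSet_box (b₁ b₂ : ℝ) : MeasurableSet (T.box b₁ b₂) := by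
  have h : Measurable fun p : Vec d × Vec d => ‖p.1 - T.θstar‖ ^ 2 :=
    Continuous.measurable (by fun_prop)
  exact (measurableSet_le h measurable_const).inter
    (measurableSet_le measurable_fastLyap measurable_const)

lemma freeStep_fst_sub {𝒳 : Type*} {g₁ g₂ : 𝒳 → Vec d → Vec d → Vec d}
    (α β : ℕ → ℝ) (n : ℕ) (p : Vec d × Vec d) (ξ : 𝒳) :
    (freeStep g₁ g₂ α β n p ξ).1 - T.θstar = (p.1 - T.θstar) + α n • g₁ ξ p.1 p.2 := by
  simp only [freeStep]; abel

lemma freeStep_snd_sub {𝒳 : Type*} {g₁ g₂ : 𝒳 → Vec d → Vec d → Vec d}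
    (α β : ℕ → ℝ) (n : ℕ) (p : Vec d × Vec d) (ξ : 𝒳) :
    (freeStep g₁ g₂ α β n p ξ).2 - T.lam (freeStep g₁ g₂ α β n p ξ).1 = (p.2 - T.lam p.1) +
      (β n • g₂ ξ p.1 p.2 + α n • (T.W₂.inverse ∘L T.Γ₂) (g₁ ξ p.1 p.2)) := by
  have h := T.lam_sub p.1 (p.1 + α n • g₁ ξ p.1 p.2)
  rw [add_sub_cancel_left, map_smul, sub_eq_iff_eq_add] at h
  simp only [freeStep, h]
  abel

variable {𝒳 : Type*} [MeasurableSpace 𝒳] {ℓ : Measure 𝒳} {g₁ g₂ : 𝒳 → Vec d → Vec d → Vec d}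

/-- The box is bounded in `(θ, w)` because `λ` is affine, so linear growth gives the uniform bound
that Hoeffding's lemma requires. -/
lemma exists_bound_on_box (hg : IsSampling T ℓ g₁ g₂) (b : ℝ) :
    ∃ H : ℝ, ∀ p ∈ T.box b b, ∀ ξ, ‖g₁ ξ p.1 p.2‖ ≤ H ∧
      ‖g₂ ξ p.1 p.2‖ + ‖(T.W₂.inverse ∘L T.Γ₂) (g₁ ξ p.1 p.2)‖ ≤ H := by
  set D := T.W₂.inverse ∘L T.Γ₂ with hD
  set tb := √b + ‖T.θstar‖
  set wb := √b + (‖T.W₂.inverse T.v₂‖ + ‖D‖ * tb)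
  set G := 2 * (1 + tb + wb) with hG
  have htb : 0 ≤ tb := by positivity
  have hwb : 0 ≤ wb := by positivity
  have hG0 : 0 ≤ G := by positivity
  refine ⟨G + ‖D‖ * G, fun p hp ξ => ?_⟩
  have h1 : ‖p.1‖ ≤ tb := by
    have e1 : ‖p.1 - T.θstar‖ ≤ √b := Real.le_sqrt_of_sq_le hp.1
    have e2 : p.1 = (p.1 - T.θstar) + T.θstar := by abel
    rw [e2]
    exact (norm_add_le _ _).trans (add_le_add_left e1 _)
  have h2 : ‖p.2‖ ≤ wb := by
    have e1 : ‖p.2 - T.lam p.1‖ ≤ √b := Real.le_sqrt_of_sq_le hp.2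
    have e2 : p.2 = (p.2 - T.lam p.1) + (T.W₂.inverse T.v₂ - D p.1) := by
      simp only [lam, hD, map_sub, ContinuousLinearMap.comp_apply]; abel
    rw [e2]
    refine (norm_add_le _ _).trans (add_le_add e1 ?_)
    refine (norm_sub_le _ _).trans (add_le_add_right ?_ _)
    exact (D.le_opNorm _).trans (by gcongr)
  have h3 : ‖g₁ ξ p.1 p.2‖ ≤ G := (hg.bound₁ ξ p.1 p.2).trans (by rw [hG]; gcongr)
  have h4 : ‖g₂ ξ p.1 p.2‖ ≤ G := (hg.bound₂ ξ p.1 p.2).trans (by rw [hG]; gcongr)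
  refine ⟨h3.trans (le_add_of_nonneg_right (by positivity)), ?_⟩
  gcongr
  exact (D.le_opNorm _).trans (by gcongr)

variable [IsProbabilityMeasure ℓ] {m k ω H s b : ℝ} {α β : ℕ → ℝ}

lemma drift_fastLyap (hg : IsSampling T ℓ g₁ g₂) (hW₂ : Coercive m T.W₂) (hm : 0 < m) (hm1 : m ≤ 1)
    (hk : 0 < k) (hst : StepSizes α β)
    (hH : ∀ p ∈ T.box b b, ∀ ξ, ‖g₁ ξ p.1 p.2‖ ≤ H ∧
      ‖g₂ ξ p.1 p.2‖ + ‖(T.W₂.inverse ∘L T.Γ₂) (g₁ ξ p.1 p.2)‖ ≤ H)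
    (hs : 0 < s) (hsC : s * (20 * (k + 1) * (H ^ 2 / m)) ≤ m / 4) {n : ℕ}
    (hr : β n / β (n + 1) ≤ 1 + m / 8 * α n) {p : Vec d × Vec d} (hp : p ∈ T.box b b) :
    ∫⁻ ξ, ENNReal.ofReal (Real.exp (s / β (n + 1) *
        T.fastLyap (freeStep g₁ g₂ α β n p ξ))) ∂ℓ ≤
      ENNReal.ofReal (Real.exp ((1 - m / 8 * β n) * (s / β n * T.fastLyap p) +
        (32 * s * (20 * (k + 1) * (H ^ 2 / m)) / m) * (m / 8 * β n))) := by
  have hpair : Measurable fun ξ : 𝒳 => (p, ξ) := measurable_prodMk_left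
  have h := exp_step_fast (ℓ := ℓ) (z := p.2 - T.lam p.1) (G₁ := fun ξ => g₁ ξ p.1 p.2)
    (G₂ := fun ξ => g₂ ξ p.1 p.2) (W₂ := T.W₂) (D := T.W₂.inverse ∘L T.Γ₂) (H := H) (m := m)
    (k := k) (α := α n) (β := β n) (s := s) (ε' := β (n + 1)) (hg.meas₁.comp hpair)
    (hg.meas₂.comp hpair) (fun ξ => (hH p hp ξ).1) (fun ξ => (hH p hp ξ).2)
    (by rw [hg.mean₂, h₂_eq (hW₂.isInvertible hm)]) hW₂ hm hm1 hk.le (hst.pos n) (hst.le n)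
    (hst.le_one n) (hst.rel n) (hst.pos_fast _) hr hs hsC
  simp only [fastLyap, freeStep_snd_sub]
  refine h.trans_eq ?_
  congr 3
  field_simp
  ring

lemma drift_slowLyap (hg : IsSampling T ℓ g₁ g₂) (hX₁ : Coercive m T.X₁) (hW₂ : Coercive m T.W₂)
    (hm : 0 < m) (hm1 : m ≤ 1) (hk : 0 < k) (hkω : 2 * ‖T.W₁‖ ^ 2 / m ^ 2 ≤ k)
    (hst : StepSizes α β)
    (hH : ∀ p ∈ T.box b b, ∀ ξ, ‖g₁ ξ p.1 p.2‖ ≤ H ∧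
      ‖g₂ ξ p.1 p.2‖ + ‖(T.W₂.inverse ∘L T.Γ₂) (g₁ ξ p.1 p.2)‖ ≤ H)
    (hs : 0 < s) (hsC : s * (20 * (k + 1) * (H ^ 2 / m)) ≤ m / 4) {n : ℕ}
    (hr : β n / β (n + 1) ≤ 1 + m / 8 * α n) {p : Vec d × Vec d} (hp : p ∈ T.box b b) :
    ∫⁻ ξ, ENNReal.ofReal (Real.exp (s / β (n + 1) *
        T.slowLyap k α β (n + 1) (freeStep g₁ g₂ α β n p ξ))) ∂ℓ ≤
      ENNReal.ofReal (Real.exp ((1 - m / 8 * α n) * (s / β n * T.slowLyap k α β n p) +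
        (32 * s * (20 * (k + 1) * (H ^ 2 / m)) / m) * (m / 8 * α n))) := by
  have hpair : Measurable fun ξ : 𝒳 => (p, ξ) := measurable_prodMk_left
  have h := exp_step_slow (ℓ := ℓ) (x := p.1 - T.θstar) (z := p.2 - T.lam p.1)
    (G₁ := fun ξ => g₁ ξ p.1 p.2) (X := T.X₁) (W := T.W₁) (ω := ‖T.W₁‖)
    (G₂ := fun ξ => g₂ ξ p.1 p.2) (W₂ := T.W₂) (D := T.W₂.inverse ∘L T.Γ₂) (H := H) (m := m)
    (k := k) (α := α n) (β := β n) (s := s) (ε' := β (n + 1))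
    (ρ' := α (n + 1) / β (n + 1)) (hg.meas₁.comp hpair)
    (hg.meas₂.comp hpair) (fun ξ => (hH p hp ξ).1) (fun ξ => (hH p hp ξ).2)
    (by rw [hg.mean₂, h₂_eq (hW₂.isInvertible hm)])
    (by rw [hg.mean₁, h₁_eq (hX₁.isInvertible hm)]) hX₁ le_rfl hW₂ hm hm1 hkω hk (hst.pos n)
    (hst.le n) (hst.le_one n) (hst.rel n) (hst.pos_fast _) (hst.anti_ratio n) hr hs hsC
  simp only [slowLyap, fastLyap, freeStep_snd_sub, freeStep_fst_sub]
  refine h.trans_eq ?_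
  congr 3
  field_simp
  ring

end TwoTimescale

/-! ### When the sparse projection acts. -/

section Projection

variable {d : ℕ}

lemma norm_ballProj_le {R : ℝ} (hR : 0 ≤ R) (x : Vec d) : ‖ballProj R x‖ ≤ R := by
  unfold ballProj
  split_ifs with h
  · exact h
  · push Not at h
    have hx : 0 < ‖x‖ := hR.trans_lt h
    rw [norm_smul, norm_div, norm_norm, Real.norm_of_nonneg hR, div_mul_cancel₀ _ hx.ne']

lemma sparseProj_eq_self {n : ℕ} {R : ℝ} {x : Vec d} (h : (∃ k : ℕ, n = 2 ^ k) → ‖x‖ ≤ R) :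
    sparseProj n R x = x := by
  unfold sparseProj
  split_ifs with hn
  · exact if_pos (h hn)
  · rfl

lemma norm_sparseProj_two_pow_le {R : ℝ} (hR : 0 ≤ R) (k : ℕ) (x : Vec d) :
    ‖sparseProj (2 ^ k) R x‖ ≤ R := by
  unfold sparseProj
  rw [if_pos ⟨k, rfl⟩]
  exact norm_ballProj_le hR x

lemma eq_two_mul_of_two_pow {i k n : ℕ} (hn : n = 2 ^ k) (h1 : 2 ^ i < n) (h2 : n < 4 * 2 ^ i) :
    n = 2 * 2 ^ i := by
  subst hn
  have e1 : i < k := (Nat.pow_lt_pow_iff_right (by norm_num)).mp h1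
  have e2 : k < i + 2 := by
    rw [← Nat.pow_lt_pow_iff_right (a := 2) (by norm_num), pow_add]
    omega
  have : k = i + 1 := by omega
  rw [this, pow_succ, mul_comm]

end Projection

section Epoch

variable {S Act : Type*} [MeasurableSpace S] [MeasurableSpace Act] {d : ℕ}
  {E : PolicyEval S Act d} {alg : Algorithm} {R₁ R₂ : ℝ} {α β : ℕ → ℝ}

lemma norm_iter_two_pow_le (hR₁ : 0 ≤ R₁) (hR₂ : 0 ≤ R₂) (x : ℕ → S × S) (θ₀ w₀ : Vec d) (i : ℕ) :
    ‖(alg.iter E α β R₁ R₂ x θ₀ w₀ (2 ^ i)).1‖ ≤ R₁ / 2 ∧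
      ‖(alg.iter E α β R₁ R₂ x θ₀ w₀ (2 ^ i)).2‖ ≤ R₂ / 2 := by
  obtain ⟨j, hj⟩ : ∃ j, 2 ^ i = j + 1 := ⟨2 ^ i - 1, (Nat.succ_pred_eq_of_pos (by positivity)).symm⟩
  have h1 := fun y : Vec d => norm_sparseProj_two_pow_le (d := d) (div_nonneg hR₁ zero_le_two) i y
  have h2 := fun y : Vec d => norm_sparseProj_two_pow_le (d := d) (div_nonneg hR₂ zero_le_two) i y
  rw [hj] at h1 h2 ⊢
  exact ⟨h1 _, h2 _⟩

end Epoch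

/-- Two reasons make an exit unlikely. At `2 * n₀` the initial value has decayed, so the small
threshold `r` suffices. At other times it may persist, but the threshold exceeds it by `1`, and `1 ≥
r`. -/
lemma logMoment_sub_le {K V s r m : ℝ} {α β η : ℕ → ℝ} {n₀ : ℕ} (hst : StepSizes α β)
    (hη0 : ∀ n, 0 ≤ η n) (hη1 : ∀ n, η n ≤ 1) (hη : ∀ n, m / 8 * α n ≤ η n) (hm : 0 < m)
    (hs : 0 < s) (hV : 0 ≤ V) (hr0 : 0 ≤ r) (hr1 : r ≤ 1)
    (hdecay : s / β n₀ * V * Real.exp (-(m / 8 * α (2 * n₀) * n₀)) ≤ 1) {j : ℕ} (hj : n₀ ≤ j) {c : ℝ}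
    (hc1 : j = 2 * n₀ → r ≤ c) (hc2 : j ≠ 2 * n₀ → V + 1 ≤ c) :
    logMoment K (s / β n₀ * V) η n₀ j - s / β j * c ≤ K + 1 - s / β n₀ * r := by
  have hβ0 := hst.pos_fast n₀
  have hβj := hst.pos_fast j
  have hmono : s / β n₀ ≤ s / β j := by
    have := hst.anti_fast hj
    gcongr
  have hs0 : 0 ≤ s / β n₀ := by positivity
  have hy : 0 ≤ s / β n₀ * V := by positivity
  by_cases hj2 : j = 2 * n₀
  · have h1 := logMoment_le_of_two_mul_le (K := K) (a := m / 8 * α (2 * n₀)) hη0 hη1 hy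
      (fun i hi => le_trans (by gcongr; exact hst.anti_slow hi.le) (hη i)) hj2.ge
    have h2 : s / β n₀ * r ≤ s / β j * c := by
      have := hc1 hj2
      gcongr
    linarith
  · have h1 := logMoment_le (K := K) (n₀ := n₀) (j := j) hη0 hη1 hy
    have h2 : s / β n₀ * (V + 1) ≤ s / β j * c := by
      have := hc2 hj2
      gcongr
    have h3 : s / β n₀ * r ≤ s / β n₀ * 1 := by gcongr
    linarith

/-! ### Deviation bound on one dyadic window. -/

section Epoch

variable {Ω S Act : Type*} [MeasurableSpace Ω] [MeasurableSpace S] [MeasurableSpace Act] {d : ℕ}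
  {E : PolicyEval S Act d} {alg : Algorithm} {R₁ R₂ : ℝ} {α β : ℕ → ℝ} {μ : Measure Ω}
  {X : ℕ → Ω → S × S} {θ₀ w₀ : Ω → Vec d}

/-- If the unprojected step ends where the projections are inactive, it is the actual step. -/
lemma iter_succ_eq_freeStep (hθ : ‖(alg.drift E).θstar‖ ≤ R₁ / 4)
    (hlam : ∀ θ : Vec d, ‖θ‖ ≤ R₁ / 2 → ‖(alg.drift E).lam θ‖ ≤ R₂ / 4)
    (hR₁ : 0 < R₁) (hR₂ : 0 < R₂) (x : ℕ → S × S) (θ w : Vec d) (n : ℕ)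
    (h : (∃ k : ℕ, n + 1 = 2 ^ k) → freeStep (alg.slowDir E) (alg.fastDir E) α β n
      (alg.iter E α β R₁ R₂ x θ w n) (x n) ∈ (alg.drift E).box ((R₁ / 4) ^ 2) ((R₂ / 4) ^ 2)) :
    alg.iter E α β R₁ R₂ x θ w (n + 1) = freeStep (alg.slowDir E) (alg.fastDir E) α β n
      (alg.iter E α β R₁ R₂ x θ w n) (x n) := by
  set q := freeStep (alg.slowDir E) (alg.fastDir E) α β n (alg.iter E α β R₁ R₂ x θ w n) (x n)
    with hq
  have key : (∃ k : ℕ, n + 1 = 2 ^ k) → ‖q.1‖ ≤ R₁ / 2 ∧ ‖q.2‖ ≤ R₂ / 2 := fun hk => by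
    obtain ⟨h1, h2⟩ := h hk
    have e1 : ‖q.1 - (alg.drift E).θstar‖ ≤ R₁ / 4 :=
      le_of_abs_le (abs_le_of_sq_le_sq h1 (by positivity))
    have e2 : ‖q.2 - (alg.drift E).lam q.1‖ ≤ R₂ / 4 :=
      le_of_abs_le (abs_le_of_sq_le_sq h2 (by positivity))
    have e3 : ‖q.1‖ ≤ R₁ / 2 := by
      have := norm_sub_norm_le q.1 (alg.drift E).θstar
      linarith
    have := norm_sub_norm_le q.2 ((alg.drift E).lam q.1)
    have := hlam q.1 e3
    exact ⟨e3, by linarith⟩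
  have e : alg.iter E α β R₁ R₂ x θ w (n + 1) =
      (sparseProj (n + 1) (R₁ / 2) q.1, sparseProj (n + 1) (R₂ / 2) q.2) := rfl
  rw [e, sparseProj_eq_self fun hk => (key hk).1, sparseProj_eq_self fun hk => (key hk).2]

variable [IsProbabilityMeasure μ] {m k H s r V : ℝ}

/-- Deviation bound within the epoch that starts at `n₀ = 2 ^ i`. -/
theorem epoch_deviation_le (hrun : IsRun E μ X θ₀ w₀)
    (hg : IsSampling (alg.drift E) E.sampleLaw (alg.slowDir E) (alg.fastDir E))
    (hR₁ : 0 < R₁) (hR₂ : 0 < R₂) (hθ : ‖(alg.drift E).θstar‖ ≤ R₁ / 4)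
    (hlam : ∀ θ : Vec d, ‖θ‖ ≤ R₁ / 2 → ‖(alg.drift E).lam θ‖ ≤ R₂ / 4)
    (hX₁ : Coercive m (alg.drift E).X₁) (hW₂ : Coercive m (alg.drift E).W₂)
    (hm : 0 < m) (hm1 : m ≤ 1) (hk : 0 < k) (hkω : 2 * ‖(alg.drift E).W₁‖ ^ 2 / m ^ 2 ≤ k)
    (hst : StepSizes α β) (hV : (3 * R₁ / 4) ^ 2 + (k + 1) * (3 * R₂ / 4) ^ 2 ≤ V)
    (hH : ∀ p ∈ (alg.drift E).box (V + 1) (V + 1), ∀ ξ, ‖alg.slowDir E ξ p.1 p.2‖ ≤ H ∧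
      ‖alg.fastDir E ξ p.1 p.2‖ +
        ‖((alg.drift E).W₂.inverse ∘L (alg.drift E).Γ₂) (alg.slowDir E ξ p.1 p.2)‖ ≤ H)
    (hs : 0 < s) (hsC : s * (20 * (k + 1) * (H ^ 2 / m)) ≤ m / 4)
    (hr0 : 0 ≤ r) (hr1 : r ≤ 1) (hrR₁ : r ≤ (R₁ / 4) ^ 2) (hrR₂ : r ≤ (R₂ / 4) ^ 2)
    {K : ℝ} (hK : K = 32 * s * (20 * (k + 1) * (H ^ 2 / m)) / m) {i : ℕ}
    (hratio : ∀ n, 2 ^ i ≤ n → β n / β (n + 1) ≤ 1 + m / 8 * α n)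
    (hdecay : s / β (2 ^ i) * V * Real.exp (-(m / 8 * α (2 * 2 ^ i) * (2 ^ i : ℕ))) ≤ 1)
    {n : ℕ} (hn : 2 * 2 ^ i ≤ n) (hn4 : n < 4 * 2 ^ i) (t : ℝ) :
    μ {ω | t * β n < alg.err E (alg.iter E α β R₁ R₂ (fun k => X k ω) (θ₀ ω) (w₀ ω) n) ^ 2} ≤
      ENNReal.ofReal (2 * n * Real.exp (K + 1 - s / β (2 ^ i) * r) +
        2 * Real.exp (K + 1 - s * t)) := by
  set T := alg.drift E with hT
  set n₀ := 2 ^ i with hn₀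
  have hn₀pos : 0 < n₀ := by positivity
  set p : ℕ → Ω → Vec d × Vec d := fun n ω =>
    alg.iter E α β R₁ R₂ (fun k => X k ω) (θ₀ ω) (w₀ ω) n with hp
  set F := freeStep (alg.slowDir E) (alg.fastDir E) α β with hF
  have hFm : ∀ n, Measurable fun q : (Vec d × Vec d) × (S × S) => F n q.1 q.2 :=
    measurable_freeStep hg α β
  have hchain : IsAdaptedChain μ E.sampleLaw hrun.filtration X p :=
    hrun.isAdaptedChain hg α β R₁ R₂
  -- The radii are tight only at `2 * n₀`, the one time strictly inside the window where a
  -- projection takes place. Elsewhere they merely keep the increments bounded.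
  set c₁ : ℕ → ℝ := fun j => if j = 2 * n₀ then (R₁ / 4) ^ 2 else V + 1 with hc₁
  set c₂ : ℕ → ℝ := fun j => if j = 2 * n₀ then (R₂ / 4) ^ 2 else V + 1 with hc₂
  have hV1 : (3 * R₁ / 4) ^ 2 ≤ V := le_trans (by nlinarith [sq_nonneg (3 * R₂ / 4)]) hV
  have hV2 : (3 * R₂ / 4) ^ 2 ≤ V :=
    le_trans (by nlinarith [sq_nonneg (3 * R₂ / 4), sq_nonneg (3 * R₁ / 4)]) hV
  have hV0 : 0 ≤ V := (sq_nonneg _).trans hV1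
  have hc₁V : ∀ j, c₁ j ≤ V + 1 := fun j => by
    simp only [hc₁]; split_ifs
    · nlinarith
    · exact le_rfl
  have hc₂V : ∀ j, c₂ j ≤ V + 1 := fun j => by
    simp only [hc₂]; split_ifs
    · nlinarith
    · exact le_rfl
  set Good : ℕ → Set (Vec d × Vec d) := fun j => T.box (c₁ j) (c₂ j) with hGood
  have hGm : ∀ j, MeasurableSet (Good j) := fun j => TwoTimescale.measurableSet_box _ _
  have hGbox : ∀ j, Good j ⊆ T.box (V + 1) (V + 1) := fun j q hq =>
    ⟨hq.1.trans (hc₁V j), hq.2.trans (hc₂V j)⟩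
  -- the state at the start of the epoch
  have hstart : ∀ ω, ‖(p n₀ ω).1 - T.θstar‖ ^ 2 ≤ (3 * R₁ / 4) ^ 2 ∧
      T.fastLyap (p n₀ ω) ≤ (3 * R₂ / 4) ^ 2 := fun ω => by
    obtain ⟨h1, h2⟩ := norm_iter_two_pow_le (E := E) (alg := alg) (α := α) (β := β) hR₁.le hR₂.le
      (fun k => X k ω) (θ₀ ω) (w₀ ω) i
    constructor
    · gcongr
      refine (norm_sub_le _ _).trans ?_
      have : ‖(p n₀ ω).1‖ ≤ R₁ / 2 := h1
      linarith
    · unfold TwoTimescale.fastLyap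
      gcongr
      refine (norm_sub_le _ _).trans ?_
      have h3 : ‖(p n₀ ω).2‖ ≤ R₂ / 2 := h2
      have h4 : ‖T.lam (p n₀ ω).1‖ ≤ R₂ / 4 := hlam _ h1
      linarith
  have hinit : ∀ ω, p n₀ ω ∈ Good n₀ := fun ω => by
    have e1 : c₁ n₀ = V + 1 := if_neg (by omega)
    have e2 : c₂ n₀ = V + 1 := if_neg (by omega)
    refine ⟨?_, ?_⟩
    · rw [e1]; linarith [(hstart ω).1]
    · rw [e2]; linarith [(hstart ω).2]
  have hstep : ∀ j, n₀ ≤ j → j + 1 < 4 * n₀ → ∀ ω, F j (p j ω) (X j ω) ∈ Good (j + 1) →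
      p (j + 1) ω = F j (p j ω) (X j ω) := fun j hj hj4 ω hω => by
    refine iter_succ_eq_freeStep hθ hlam hR₁ hR₂ _ _ _ j fun ⟨l, hl⟩ => ?_
    -- No other power of two lies strictly between `n₀` and `4 * n₀`.
    have e := eq_two_mul_of_two_pow hl (by omega : 2 ^ i < j + 1) hj4
    have e1 : c₁ (j + 1) = (R₁ / 4) ^ 2 := if_pos e
    have e2 : c₂ (j + 1) = (R₂ / 4) ^ 2 := if_pos e
    rw [← e1, ← e2]
    exact hω
  -- the two exponential moments
  have hα0 := fun n => (hst.pos n).le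
  have hβ0 := fun n => (hst.pos_fast n).le
  have hηs0 : ∀ n, 0 ≤ m / 8 * α n := fun n => mul_nonneg (by positivity) (hα0 n)
  have hηf0 : ∀ n, 0 ≤ m / 8 * β n := fun n => mul_nonneg (by positivity) (hβ0 n)
  have hηf1 : ∀ n, m / 8 * β n ≤ 1 := fun n =>
    mul_le_one₀ (by linarith) (hβ0 n) (hst.le_one n)
  have hηsf : ∀ n, m / 8 * α n ≤ m / 8 * β n := fun n =>
    mul_le_mul_of_nonneg_left (hst.le n) (by positivity)
  have hηs1 : ∀ n, m / 8 * α n ≤ 1 := fun n => (hηsf n).trans (hηf1 n)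
  have hK0 : 0 ≤ K := by rw [hK]; positivity
  have hsβ : 0 ≤ s / β n₀ := div_nonneg hs.le (hβ0 _)
  have tailF : ∀ j, n₀ ≤ j → j < 4 * n₀ → ∀ w, _ := fun j hj hj1 w =>
    measure_alive_inter_le (μ := μ) (n₁ := 4 * n₀) (W := fun n q => s / β n * T.fastLyap q)
      (η := fun n => m / 8 * β n) (K := K) (y₀ := s / β n₀ * V) hchain hFm hGm hinit hstep
      (fun n => TwoTimescale.measurable_fastLyap.const_mul _) hηf0 hηf1 hK0
      (fun j hj hj1 q hq => by
        rw [hK]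
        exact TwoTimescale.drift_fastLyap hg hW₂ hm hm1 hk hst hH hs hsC (hratio j hj)
          (hGbox j hq))
      (fun ω => mul_le_mul_of_nonneg_left ((hstart ω).2.trans hV2) hsβ) hj hj1 w
  have tailS : ∀ j, n₀ ≤ j → j < 4 * n₀ → ∀ w, _ := fun j hj hj1 w =>
    measure_alive_inter_le (μ := μ) (n₁ := 4 * n₀) (W := fun n q => s / β n * T.slowLyap k α β n q)
      (η := fun n => m / 8 * α n) (K := K) (y₀ := s / β n₀ * V) hchain hFm hGm hinit hstep
      (fun n => (TwoTimescale.measurable_slowLyap k α β n).const_mul _) hηs0 hηs1 hK0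
      (fun j hj hj1 q hq => by
        rw [hK]
        exact TwoTimescale.drift_slowLyap hg hX₁ hW₂ hm hm1 hk hkω hst hH hs hsC (hratio j hj)
          (hGbox j hq))
      (fun ω => by
        refine mul_le_mul_of_nonneg_left (le_trans ?_ hV) hsβ
        have hρ : α n₀ / β n₀ ≤ 1 := (div_le_one (hst.pos_fast _)).mpr (hst.le _)
        have e1 : k * (α n₀ / β n₀) * T.fastLyap (p n₀ ω) ≤ (k + 1) * (3 * R₂ / 4) ^ 2 := by
          have hρ0 : 0 ≤ α n₀ / β n₀ := div_nonneg (hα0 _) (hβ0 _)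
          refine mul_le_mul ?_ (hstart ω).2 (TwoTimescale.fastLyap_nonneg _) (by positivity)
          nlinarith
        exact add_le_add (hstart ω).1 e1) hj hj1 w
  have slow_ge : ∀ j q, ‖q.1 - T.θstar‖ ^ 2 ≤ T.slowLyap k α β j q := fun j q =>
    le_add_of_nonneg_right (mul_nonneg (mul_nonneg hk.le (div_nonneg (hα0 _) (hβ0 _)))
      (TwoTimescale.fastLyap_nonneg _))
  -- one step leaves the good set
  have hexit : ∀ j ∈ Finset.Ico n₀ n,
      μ (alive F X p Good n₀ j ∩ {ω | F j (p j ω) (X j ω) ∉ Good (j + 1)}) ≤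
        ENNReal.ofReal (2 * Real.exp (K + 1 - s / β n₀ * r)) := fun j hj => by
    obtain ⟨hj0, hjn⟩ := Finset.mem_Ico.mp hj
    have hsj : 0 ≤ s / β (j + 1) := div_nonneg hs.le (hβ0 _)
    have hsub : alive F X p Good n₀ j ∩ {ω | F j (p j ω) (X j ω) ∉ Good (j + 1)} ⊆
        (alive F X p Good n₀ j ∩ {ω | s / β (j + 1) * c₁ (j + 1) ≤
          s / β (j + 1) * T.slowLyap k α β (j + 1) (F j (p j ω) (X j ω))}) ∪
        (alive F X p Good n₀ j ∩ {ω | s / β (j + 1) * c₂ (j + 1) ≤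
          s / β (j + 1) * T.fastLyap (F j (p j ω) (X j ω))}) := by
      rintro ω ⟨hω, hbad⟩
      by_cases h1 : ‖(F j (p j ω) (X j ω)).1 - T.θstar‖ ^ 2 ≤ c₁ (j + 1)
      · refine Or.inr ⟨hω, mul_le_mul_of_nonneg_left ?_ hsj⟩
        by_contra h2
        exact hbad ⟨h1, (not_le.mp h2).le⟩
      · exact Or.inl ⟨hω, mul_le_mul_of_nonneg_left ((not_le.mp h1).le.trans (slow_ge _ _)) hsj⟩
    refine (measure_mono hsub).trans ((measure_union_le _ _).trans ?_)
    rw [two_mul, ENNReal.ofReal_add (Real.exp_pos _).le (Real.exp_pos _).le]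
    refine add_le_add ((tailS j hj0 (by omega) _).trans ?_) ((tailF j hj0 (by omega) _).trans ?_)
    · refine ENNReal.ofReal_le_ofReal (Real.exp_le_exp.mpr ?_)
      exact logMoment_sub_le hst hηs0 hηs1 (fun n => le_rfl) hm hs hV0 hr0 hr1 hdecay (by omega)
        (fun e => by rw [hc₁]; simp only [if_pos e]; exact hrR₁)
        (fun e => by rw [hc₁]; simp only [if_neg e]; exact le_rfl)
    · refine ENNReal.ofReal_le_ofReal (Real.exp_le_exp.mpr ?_)
      exact logMoment_sub_le hst hηf0 hηf1 hηsf hm hs hV0 hr0 hr1 hdecay (by omega)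
        (fun e => by rw [hc₂]; simp only [if_pos e]; exact hrR₂)
        (fun e => by rw [hc₂]; simp only [if_neg e]; exact le_rfl)
  have hdead : μ (alive F X p Good n₀ n)ᶜ ≤
      ENNReal.ofReal (2 * n * Real.exp (K + 1 - s / β n₀ * r)) := by
    refine (measure_compl_alive_le (by omega)).trans ((Finset.sum_le_sum hexit).trans ?_)
    rw [Finset.sum_const, nsmul_eq_mul, Nat.card_Ico, ← ENNReal.ofReal_natCast,
      ← ENNReal.ofReal_mul (Nat.cast_nonneg _)]
    refine ENNReal.ofReal_le_ofReal ?_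
    have : ((n - n₀ : ℕ) : ℝ) ≤ n := by exact_mod_cast Nat.sub_le _ _
    calc _ ≤ (n : ℝ) * (2 * Real.exp (K + 1 - s / β n₀ * r)) := by gcongr
      _ = _ := by ring
  -- deviation of the last iterate
  obtain ⟨l, rfl⟩ : ∃ l, n = l + 1 := ⟨n - 1, by omega⟩
  have hβn := hst.pos_fast (l + 1)
  have hsn : 0 ≤ s / β (l + 1) := div_nonneg hs.le (hβ0 _)
  have hsub : {ω | t * β (l + 1) < alg.err E (p (l + 1) ω) ^ 2} ⊆
      (alive F X p Good n₀ (l + 1))ᶜ ∪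
      ((alive F X p Good n₀ l ∩ {ω | s / β (l + 1) * (t * β (l + 1)) ≤
          s / β (l + 1) * T.slowLyap k α β (l + 1) (F l (p l ω) (X l ω))}) ∪
        (alive F X p Good n₀ l ∩ {ω | s / β (l + 1) * (t * β (l + 1)) ≤
          s / β (l + 1) * T.fastLyap (F l (p l ω) (X l ω))})) := by
    intro ω hω
    by_cases ha : ω ∈ alive F X p Good n₀ (l + 1)
    · refine Or.inr ?_
      have e := hstep l (by omega) hn4 ω (ha l (by omega) (Nat.lt_succ_self l))
      have ha' := alive_anti (Nat.le_succ l) ha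
      have hω' : t * β (l + 1) < alg.err E (p (l + 1) ω) ^ 2 := hω
      rw [e, Algorithm.err] at hω'
      rcases max_choice ‖(F l (p l ω) (X l ω)).1 - T.θstar‖
        ‖(F l (p l ω) (X l ω)).2 - T.lam (F l (p l ω) (X l ω)).1‖ with h | h
      · rw [h] at hω'
        exact Or.inl ⟨ha', mul_le_mul_of_nonneg_left (hω'.le.trans (slow_ge _ _)) hsn⟩
      · rw [h] at hω'
        exact Or.inr ⟨ha', mul_le_mul_of_nonneg_left hω'.le hsn⟩
    · exact Or.inl ha
  -- After `2 * n₀` the initial value contributes at most `1`, and the level `t * β` is exactly `s *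
  -- t` on the scale of the exponent.
  have hlog : ∀ η : ℕ → ℝ, (∀ n, 0 ≤ η n) → (∀ n, η n ≤ 1) → (∀ n, m / 8 * α n ≤ η n) →
      logMoment K (s / β n₀ * V) η n₀ (l + 1) - s / β (l + 1) * (t * β (l + 1)) ≤
        K + 1 - s * t := fun η h0 h1 hη => by
    have e1 := logMoment_le_of_two_mul_le (K := K) (a := m / 8 * α (2 * n₀)) h0 h1
      (mul_nonneg hsβ hV0) (fun i hi => le_trans (by gcongr; exact hst.anti_slow hi.le) (hη i)) hn
    have e2 : s / β (l + 1) * (t * β (l + 1)) = s * t := by field_simp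
    rw [e2]
    linarith
  refine (measure_mono hsub).trans ((measure_union_le _ _).trans ?_)
  rw [ENNReal.ofReal_add (by positivity) (by positivity)]
  refine add_le_add hdead ((measure_union_le _ _).trans ?_)
  rw [two_mul, ENNReal.ofReal_add (Real.exp_pos _).le (Real.exp_pos _).le]
  refine add_le_add ((tailS l (by omega) (by omega) _).trans ?_)
    ((tailF l (by omega) (by omega) _).trans ?_)
  · exact ENNReal.ofReal_le_ofReal (Real.exp_le_exp.mpr (hlog _ hηs0 hηs1 fun n => le_rfl))
  · exact ENNReal.ofReal_le_ofReal (Real.exp_le_exp.mpr (hlog _ hηf0 hηf1 hηsf))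

end Epoch

/-! ### Power step sizes. -/

section Asymptotics

open Filter

lemma eventually_mul_exp_neg_rpow_le {e c : ℝ} (he : 0 < e) (hc : 0 < c) (A : ℝ) :
    ∀ᶠ n : ℕ in atTop, A * n * Real.exp (-(c * (n : ℝ) ^ e)) ≤ 1 := by
  have h1 : Tendsto (fun n : ℕ => (n : ℝ) ^ e) atTop atTop :=
    (tendsto_rpow_atTop he).comp tendsto_natCast_atTop_atTop
  have h2 := ((tendsto_rpow_mul_exp_neg_mul_atTop_nhds_zero (1 / e) c hc).comp h1).const_mul A
  rw [mul_zero] at h2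
  filter_upwards [h2.eventually_le_const one_pos] with n hn
  simp only [Function.comp] at hn
  rw [← Real.rpow_mul (Nat.cast_nonneg n), mul_one_div_cancel he.ne', Real.rpow_one] at hn
  rwa [mul_assoc, ← neg_mul]

lemma eventually_exp_neg_rpow_le {e c δ : ℝ} (he : 0 < e) (hc : 0 < c) (hδ : 0 < δ) :
    ∀ᶠ n : ℕ in atTop, Real.exp (-c * (n : ℝ) ^ e) ≤ δ := by
  filter_upwards [eventually_mul_exp_neg_rpow_le he hc δ⁻¹, eventually_ge_atTop 1] with n hn hn1
  have hn1' : (1 : ℝ) ≤ n := by exact_mod_cast hn1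
  rw [neg_mul]
  have h3 : δ⁻¹ * 1 * Real.exp (-(c * (n : ℝ) ^ e)) ≤ 1 := le_trans (by gcongr) hn
  rw [mul_one, inv_mul_le_iff₀ hδ, mul_one] at h3
  exact h3

variable {κ : ℝ} {α β : ℕ → ℝ}

lemma stepSizes_rpow (hκ₀ : 0 < κ) (hκ₁ : κ < 1)
    (hα : ∀ n : ℕ, α n = ((n : ℝ) + 1) ^ (-(1 - κ)))
    (hβ : ∀ n : ℕ, β n = ((n : ℝ) + 1) ^ (-((2 / 3) * (1 - κ)))) : StepSizes α β where
  pos n := by rw [hα]; positivity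
  le n := by
    rw [hα, hβ]
    exact Real.rpow_le_rpow_of_exponent_le (by linarith [Nat.cast_nonneg (α := ℝ) n]) (by linarith)
  le_one n := by
    rw [hβ]
    exact Real.rpow_le_one_of_one_le_of_nonpos (by linarith [Nat.cast_nonneg (α := ℝ) n])
      (by linarith)
  rel n := by
    have h0 : (0 : ℝ) ≤ (n : ℝ) + 1 := by positivity
    rw [hα, hβ, ← Real.rpow_mul_natCast h0, ← Real.rpow_mul_natCast h0]
    congr 1
    push_cast
    ring
  anti_slow i j hij := by
    rw [hα, hα]
    exact Real.rpow_le_rpow_of_nonpos (by positivity) (by gcongr) (by linarith)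
  anti_fast i j hij := by
    rw [hβ, hβ]
    exact Real.rpow_le_rpow_of_nonpos (by positivity) (by gcongr) (by linarith)
  anti_ratio n := by
    rw [hα, hα, hβ, hβ, ← Real.rpow_sub (by positivity), ← Real.rpow_sub (by positivity)]
    exact Real.rpow_le_rpow_of_nonpos (by positivity) (by push_cast; linarith) (by linarith)

/-- The ratio is at most `1 + 1 / (n + 1)`, and `1 / (n + 1)` is `α n` times `(n + 1) ^ (-κ)`. This
uses `κ > 0`. -/
lemma eventually_ratio_le (hκ₀ : 0 < κ) (hκ₁ : κ < 1)
    (hα : ∀ n : ℕ, α n = ((n : ℝ) + 1) ^ (-(1 - κ)))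
    (hβ : ∀ n : ℕ, β n = ((n : ℝ) + 1) ^ (-((2 / 3) * (1 - κ)))) {c : ℝ} (hc : 0 < c) :
    ∀ᶠ n : ℕ in atTop, β n / β (n + 1) ≤ 1 + c * α n := by
  have h1 : Tendsto (fun n : ℕ => (n : ℝ) ^ κ) atTop atTop :=
    (tendsto_rpow_atTop hκ₀).comp tendsto_natCast_atTop_atTop
  filter_upwards [h1.eventually_ge_atTop c⁻¹] with n hn
  have hn0 : (0 : ℝ) ≤ n := Nat.cast_nonneg n
  have hx : (0 : ℝ) < (n : ℝ) + 1 := by positivity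
  have e1 : β n / β (n + 1) ≤ 1 + ((n : ℝ) + 1)⁻¹ := by
    rw [hβ, hβ, Real.rpow_neg hx.le, Real.rpow_neg (by positivity), inv_div_inv,
      ← Real.div_rpow (by positivity) hx.le]
    have e2 : ((n + 1 : ℕ) + 1 : ℝ) / ((n : ℝ) + 1) = 1 + ((n : ℝ) + 1)⁻¹ := by
      push_cast; field_simp
    rw [e2]
    calc (1 + ((n : ℝ) + 1)⁻¹) ^ (2 / 3 * (1 - κ)) ≤ (1 + ((n : ℝ) + 1)⁻¹) ^ (1 : ℝ) :=
          Real.rpow_le_rpow_of_exponent_le (le_add_of_nonneg_right (by positivity)) (by linarith)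
      _ = _ := Real.rpow_one _
  refine e1.trans ?_
  gcongr
  rw [hα]
  have e3 : ((n : ℝ) + 1) ^ (-(1 - κ)) = ((n : ℝ) + 1)⁻¹ * ((n : ℝ) + 1) ^ κ := by
    rw [← Real.rpow_neg_one, ← Real.rpow_add hx]; congr 1; ring
  have e4 : c⁻¹ ≤ ((n : ℝ) + 1) ^ κ := hn.trans (by gcongr; linarith)
  have e5 : 1 ≤ c * ((n : ℝ) + 1) ^ κ := by
    rwa [inv_le_iff_one_le_mul₀' hc] at e4
  rw [e3]
  calc ((n : ℝ) + 1)⁻¹ = ((n : ℝ) + 1)⁻¹ * 1 := (mul_one _).symm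
    _ ≤ ((n : ℝ) + 1)⁻¹ * (c * ((n : ℝ) + 1) ^ κ) := by gcongr
    _ = _ := by ring

/-- `α (2 * n) * n` is at least `n ^ κ / 3`, while `1 / β n` grows at most linearly. This also needs
`κ > 0`. -/
lemma eventually_initial_decay (hκ₀ : 0 < κ) (hκ₁ : κ < 1)
    (hα : ∀ n : ℕ, α n = ((n : ℝ) + 1) ^ (-(1 - κ)))
    (hβ : ∀ n : ℕ, β n = ((n : ℝ) + 1) ^ (-((2 / 3) * (1 - κ)))) {s V c : ℝ} (hs : 0 ≤ s)
    (hV : 0 ≤ V) (hc : 0 < c) :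
    ∀ᶠ n : ℕ in atTop, s / β n * V * Real.exp (-(c * α (2 * n) * (n : ℕ))) ≤ 1 := by
  filter_upwards [eventually_mul_exp_neg_rpow_le hκ₀ (by positivity : 0 < c / 3) (2 * (s * V)),
    eventually_ge_atTop 1] with n hn hn1
  have hn1' : (1 : ℝ) ≤ n := by exact_mod_cast hn1
  have hn0 : (0 : ℝ) < n := by linarith
  refine le_trans ?_ hn
  have e1 : (β n)⁻¹ ≤ 2 * n := by
    rw [hβ, ← Real.rpow_neg (by positivity), neg_neg]
    calc ((n : ℝ) + 1) ^ (2 / 3 * (1 - κ)) ≤ ((n : ℝ) + 1) ^ (1 : ℝ) :=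
          Real.rpow_le_rpow_of_exponent_le (by linarith) (by linarith)
      _ = n + 1 := Real.rpow_one _
      _ ≤ 2 * n := by linarith
  have e2 : c / 3 * (n : ℝ) ^ κ ≤ c * α (2 * n) * (n : ℕ) := by
    have e3 : (3 * (n : ℝ)) ^ (-(1 - κ)) ≤ α (2 * n) := by
      rw [hα]
      exact Real.rpow_le_rpow_of_nonpos (by positivity) (by push_cast; linarith) (by linarith)
    have e4 : (3 : ℝ)⁻¹ ≤ 3 ^ (-(1 - κ)) := by
      rw [← Real.rpow_neg_one]
      exact Real.rpow_le_rpow_of_exponent_le (by norm_num) (by linarith)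
    calc c / 3 * (n : ℝ) ^ κ = c * (3⁻¹ * (n : ℝ) ^ (-(1 - κ))) * n := by
          have : (n : ℝ) ^ κ = (n : ℝ) ^ (-(1 - κ)) * n := by
            nth_rw 3 [← Real.rpow_one (n : ℝ)]
            rw [← Real.rpow_add hn0]; congr 1; ring
          rw [this]; ring
      _ ≤ c * (3 ^ (-(1 - κ)) * (n : ℝ) ^ (-(1 - κ))) * n := by gcongr
      _ = c * (3 * (n : ℝ)) ^ (-(1 - κ)) * n := by rw [Real.mul_rpow (by norm_num) hn0.le]
      _ ≤ _ := by gcongr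
  calc s / β n * V * Real.exp (-(c * α (2 * n) * (n : ℕ)))
      = s * V * (β n)⁻¹ * Real.exp (-(c * α (2 * n) * (n : ℕ))) := by ring
    _ ≤ s * V * (2 * n) * Real.exp (-(c / 3 * (n : ℝ) ^ κ)) := by gcongr
    _ = _ := by ring

end Asymptotics

/-! ### Choice of constants and early times. -/

section Main

variable {S Act : Type*} [MeasurableSpace S] [MeasurableSpace Act] {d : ℕ}
  {E : PolicyEval S Act d} {alg : Algorithm} {R₁ R₂ κ : ℝ} {α β : ℕ → ℝ}

/-- Deviation bound for all large times, uniform in the run. -/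
theorem exists_deviation_le (hr : ∀ s, |E.r s| ≤ 1) (hφ : ∀ s, ‖E.φ s‖ ≤ 1) (hΦ : E.FullRank)
    (hR₁ : 0 < R₁) (hR₂ : 0 < R₂) (hθ : ‖(alg.drift E).θstar‖ ≤ R₁ / 4)
    (hlam : ∀ θ : Vec d, ‖θ‖ ≤ R₁ / 2 → ‖(alg.drift E).lam θ‖ ≤ R₂ / 4)
    (hκ₀ : 0 < κ) (hκ₁ : κ < 1) (hα : ∀ n : ℕ, α n = ((n : ℝ) + 1) ^ (-(1 - κ)))
    (hβ : ∀ n : ℕ, β n = ((n : ℝ) + 1) ^ (-((2 / 3) * (1 - κ)))) :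
    ∃ M s c : ℝ, 0 < M ∧ 0 < s ∧ 0 < c ∧ ∃ N : ℕ,
      ∀ {Ω : Type*} [MeasurableSpace Ω] (μ : Measure Ω) [IsProbabilityMeasure μ]
        (X : ℕ → Ω → S × S) (θ₀ w₀ : Ω → Vec d), IsRun E μ X θ₀ w₀ → ∀ n : ℕ, N ≤ n → ∀ t : ℝ,
        μ {ω | t * β n < alg.err E
            (alg.iter E α β R₁ R₂ (fun k => X k ω) (θ₀ ω) (w₀ ω) n) ^ 2} ≤
          ENNReal.ofReal (Real.exp (-c * (n : ℝ) ^ ((2 / 3) * (1 - κ))) / 2 +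
            M * Real.exp (-(s * t))) := by
  obtain ⟨m, hm, hm1, hX₁, hW₂⟩ := Algorithm.exists_coercive_drift hφ hΦ alg
  have hg := Algorithm.isSampling hr hφ alg
  have hst := stepSizes_rpow hκ₀ hκ₁ hα hβ
  set k := 2 * ‖(alg.drift E).W₁‖ ^ 2 / m ^ 2 + 1 with hk
  have hk0 : 0 < k := by positivity
  set V := (3 * R₁ / 4) ^ 2 + (k + 1) * (3 * R₂ / 4) ^ 2 with hV
  have hV0 : 0 ≤ V := by positivity
  obtain ⟨H, hH⟩ := TwoTimescale.exists_bound_on_box hg (V + 1)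
  set Q := 20 * (k + 1) * (H ^ 2 / m) with hQ
  have hQ0 : 0 ≤ Q := by positivity
  -- The `+ 1` keeps the denominator positive if `Q = 0`.
  set s := m / 4 / (Q + 1) with hs
  have hs0 : 0 < s := by positivity
  have hsQ : s * Q ≤ m / 4 := by
    rw [hs, div_mul_eq_mul_div, div_le_iff₀ (by positivity)]
    nlinarith
  set r := min 1 (min ((R₁ / 4) ^ 2) ((R₂ / 4) ^ 2)) with hr_def
  have hr0 : 0 < r := by positivity
  set K := 32 * s * Q / m with hK
  have hb : 0 < 2 / 3 * (1 - κ) := by linarith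
  obtain ⟨N₁, hN₁⟩ := Filter.eventually_atTop.mp
    ((eventually_ratio_le hκ₀ hκ₁ hα hβ (by positivity : 0 < m / 8)).and
      (eventually_initial_decay hκ₀ hκ₁ hα hβ hs0.le hV0 (by positivity : 0 < m / 8)))
  obtain ⟨N₂, hN₂⟩ := Filter.eventually_atTop.mp (eventually_mul_exp_neg_rpow_le hb
    (by positivity : 0 < s * r / 8) (4 * Real.exp (K + 1)))
  -- `4 * N₁` guarantees `N₁ ≤ 2 ^ i`, since `n < 4 * 2 ^ i`; the summand `2` makes `Nat.log 2 n`
  -- positive.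
  refine ⟨2 * Real.exp (K + 1), s, s * r / 8, by positivity, hs0, by positivity,
    4 * N₁ + N₂ + 2, fun μ _ X θ₀ w₀ hrun n hn t => ?_⟩
  obtain ⟨i, hi1, hi2⟩ : ∃ i : ℕ, 2 * 2 ^ i ≤ n ∧ n < 4 * 2 ^ i := by
    have h1 : 1 ≤ Nat.log 2 n := Nat.log_pos (by norm_num) (by omega)
    refine ⟨Nat.log 2 n - 1, ?_, ?_⟩
    · have := Nat.pow_log_le_self 2 (x := n) (by omega)
      rwa [mul_comm, ← pow_succ, Nat.sub_add_cancel h1]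
    · have := Nat.lt_pow_succ_log_self (b := 2) (by norm_num) n
      rw [show (4 : ℕ) = 2 ^ 2 by norm_num, ← pow_add]
      convert this using 2
      omega
  have hi : N₁ ≤ 2 ^ i := by omega
  have h := epoch_deviation_le hrun hg hR₁ hR₂ hθ hlam hX₁ hW₂ hm hm1 hk0 (by rw [hk]; linarith)
    hst le_rfl hH hs0 hsQ hr0.le (min_le_left _ _) ((min_le_right _ _).trans (min_le_left _ _))
    ((min_le_right _ _).trans (min_le_right _ _)) hK (fun n hn => (hN₁ n (hi.trans hn)).1)
    (hN₁ _ hi).2 hi1 hi2 t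
  refine h.trans (ENNReal.ofReal_le_ofReal (add_le_add ?_ (le_of_eq ?_)))
  · have hn0 : (0 : ℝ) ≤ n := Nat.cast_nonneg n
    set b := 2 / 3 * (1 - κ) with hb_def
    have e1 : (n : ℝ) ^ b / 4 ≤ (β (2 ^ i))⁻¹ := by
      rw [hβ, ← Real.rpow_neg (by positivity), neg_neg]
      have e2 : (4 : ℝ) ^ b ≤ 4 := by
        calc (4 : ℝ) ^ b ≤ 4 ^ (1 : ℝ) :=
              Real.rpow_le_rpow_of_exponent_le (by norm_num) (by linarith)
          _ = 4 := Real.rpow_one _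
      calc (n : ℝ) ^ b / 4 ≤ (n : ℝ) ^ b / 4 ^ b := by gcongr
        _ = ((n : ℝ) / 4) ^ b := (Real.div_rpow hn0 (by norm_num) _).symm
        _ ≤ _ := by
          have : (n : ℝ) < 4 * (2 ^ i : ℕ) := by exact_mod_cast hi2
          gcongr
          linarith
    have e3 : s * r / 4 * (n : ℝ) ^ b ≤ s / β (2 ^ i) * r := by
      calc s * r / 4 * (n : ℝ) ^ b = s * r * ((n : ℝ) ^ b / 4) := by ring
        _ ≤ s * r * (β (2 ^ i))⁻¹ := by gcongr
        _ = _ := by ring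
    have e4 := hN₂ n (by omega)
    set y := (n : ℝ) ^ b
    calc 2 * (n : ℝ) * Real.exp (K + 1 - s / β (2 ^ i) * r)
        ≤ 2 * (n : ℝ) * Real.exp (K + 1 - s * r / 4 * y) := by gcongr
      -- One half of the exponent kills the factor `n` from the union bound, the other half remains.
      _ = 4 * Real.exp (K + 1) * n * Real.exp (-(s * r / 8 * y)) *
            (Real.exp (-(s * r / 8) * y) / 2) := by
          rw [show K + 1 - s * r / 4 * y = K + 1 + (-(s * r / 8 * y) + -(s * r / 8) * y) by ring,
            Real.exp_add (K + 1), Real.exp_add (-(s * r / 8 * y))]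
          ring
      _ ≤ 1 * (Real.exp (-(s * r / 8) * y) / 2) := by gcongr
      _ = _ := one_mul _
  · rw [sub_eq_add_neg, Real.exp_add, mul_assoc]

lemma norm_sparseProj_le {d : ℕ} (n : ℕ) {R : ℝ} (hR : 0 ≤ R) (x : Vec d) :
    ‖sparseProj n R x‖ ≤ ‖x‖ := by
  unfold sparseProj ballProj
  split_ifs with h1 h2
  · exact le_rfl
  · push Not at h2
    have hx : 0 < ‖x‖ := hR.trans_lt h2
    rw [norm_smul, norm_div, norm_norm, Real.norm_of_nonneg hR, div_mul_cancel₀ _ hx.ne']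
    exact h2.le
  · exact le_rfl

/-- Time `1 = 2 ^ 0` is a projection time, so the initial values are forgotten there; afterwards
each step grows at most linearly. -/
lemma exists_norm_iter_le (hr : ∀ s, |E.r s| ≤ 1) (hφ : ∀ s, ‖E.φ s‖ ≤ 1) (hR₁ : 0 < R₁)
    (hR₂ : 0 < R₂) {n : ℕ} (hn : 1 ≤ n) :
    ∃ D : ℝ, ∀ (x : ℕ → S × S) (θ₀ w₀ : Vec d),
      ‖(alg.iter E α β R₁ R₂ x θ₀ w₀ n).1‖ ≤ D ∧ ‖(alg.iter E α β R₁ R₂ x θ₀ w₀ n).2‖ ≤ D := by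
  induction n, hn using Nat.le_induction with
  | base =>
    refine ⟨max (R₁ / 2) (R₂ / 2), fun x θ₀ w₀ => ?_⟩
    obtain ⟨h1, h2⟩ := norm_iter_two_pow_le (E := E) (alg := alg) (α := α) (β := β) hR₁.le hR₂.le
      x θ₀ w₀ 0
    exact ⟨h1.trans (le_max_left _ _), h2.trans (le_max_right _ _)⟩
  | succ n hn ih =>
    obtain ⟨D, hD⟩ := ih
    have hg := Algorithm.isSampling hr hφ alg
    refine ⟨D + (|α n| + |β n|) * (2 * (1 + D + D)), fun x θ₀ w₀ => ?_⟩
    obtain ⟨h1, h2⟩ := hD x θ₀ w₀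
    set q := alg.iter E α β R₁ R₂ x θ₀ w₀ n with hq
    have hD0 : 0 ≤ D := (norm_nonneg _).trans h1
    have hb : 2 * (1 + ‖q.1‖ + ‖q.2‖) ≤ 2 * (1 + D + D) := by linarith
    have e1 := (hg.bound₁ (x n) q.1 q.2).trans hb
    have e2 := (hg.bound₂ (x n) q.1 q.2).trans hb
    constructor
    · refine (norm_sparseProj_le _ (by positivity) _).trans ((norm_add_le _ _).trans ?_)
      refine add_le_add h1 ?_
      rw [norm_smul, Real.norm_eq_abs]
      exact mul_le_mul (by linarith [abs_nonneg (β n)]) e1 (norm_nonneg _) (by positivity)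
    · refine (norm_sparseProj_le _ (by positivity) _).trans ((norm_add_le _ _).trans ?_)
      refine add_le_add h2 ?_
      rw [norm_smul, Real.norm_eq_abs]
      exact mul_le_mul (by linarith [abs_nonneg (α n)]) e2 (norm_nonneg _) (by positivity)

lemma exists_err_le (hr : ∀ s, |E.r s| ≤ 1) (hφ : ∀ s, ‖E.φ s‖ ≤ 1) (hR₁ : 0 < R₁)
    (hR₂ : 0 < R₂) {n : ℕ} (hn : 1 ≤ n) :
    ∃ D : ℝ, ∀ (x : ℕ → S × S) (θ₀ w₀ : Vec d),
      alg.err E (alg.iter E α β R₁ R₂ x θ₀ w₀ n) ≤ D := by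
  obtain ⟨D, hD⟩ := exists_norm_iter_le (α := α) (β := β) (alg := alg) hr hφ hR₁ hR₂ hn
  obtain ⟨B, hB⟩ := (isCompact_closedBall (0 : Vec d) D).exists_bound_of_continuousOn
    (alg.drift E).continuous_lam.continuousOn
  refine ⟨max (D + ‖(alg.drift E).θstar‖) (D + B), fun x θ₀ w₀ => ?_⟩
  obtain ⟨h1, h2⟩ := hD x θ₀ w₀
  refine max_le_max ((norm_sub_le _ _).trans (by gcongr))
    ((norm_sub_le _ _).trans (add_le_add h2 (hB _ (by simpa using h1))))

/-- Bound, with the claimed rate, for the finitely many times before `N`. -/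
lemma exists_err_le_mul_rpow (hr : ∀ s, |E.r s| ≤ 1) (hφ : ∀ s, ‖E.φ s‖ ≤ 1) (hR₁ : 0 < R₁)
    (hR₂ : 0 < R₂) (e : ℝ) (N : ℕ) :
    ∃ D : ℝ, 0 ≤ D ∧ ∀ n, 1 ≤ n → n < N → ∀ (x : ℕ → S × S) (θ₀ w₀ : Vec d),
      alg.err E (alg.iter E α β R₁ R₂ x θ₀ w₀ n) ≤ D * (n : ℝ) ^ e := by
  have h : ∀ n : ℕ, ∃ D : ℝ, 1 ≤ n → ∀ (x : ℕ → S × S) (θ₀ w₀ : Vec d),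
      alg.err E (alg.iter E α β R₁ R₂ x θ₀ w₀ n) ≤ D := fun n => by
    by_cases hn : 1 ≤ n
    · obtain ⟨D, hD⟩ := exists_err_le (α := α) (β := β) (alg := alg) hr hφ hR₁ hR₂ hn
      exact ⟨D, fun _ => hD⟩
    · exact ⟨0, fun h => absurd h hn⟩
  choose D hD using h
  refine ⟨∑ n ∈ Finset.range N, |D n| * (n : ℝ) ^ (-e), by positivity,
    fun n hn hnN x θ₀ w₀ => (hD n hn x θ₀ w₀).trans ?_⟩
  have hn0 : (0 : ℝ) < n := by exact_mod_cast hn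
  calc D n ≤ |D n| := le_abs_self _
    _ = |D n| * (n : ℝ) ^ (-e) * (n : ℝ) ^ e := by
      rw [mul_assoc, ← Real.rpow_add hn0]; simp
    _ ≤ _ := by
      gcongr
      exact Finset.single_le_sum (f := fun n : ℕ => |D n| * (n : ℝ) ^ (-e))
        (fun i _ => by positivity) (Finset.mem_range.mpr hnN)

lemma le_measureReal_of_measure_compl_le {Ω : Type*} [MeasurableSpace Ω] {μ : Measure Ω}
    [IsProbabilityMeasure μ] {G B : Set Ω} {δ : ℝ} (hδ : 0 ≤ δ) (hsub : Gᶜ ⊆ B)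
    (hB : μ B ≤ ENNReal.ofReal δ) : 1 - δ ≤ μ.real G := by
  have h1 : μ.real B ≤ δ := ENNReal.toReal_le_of_le_ofReal hδ hB
  have h2 : μ.real Gᶜ ≤ μ.real B := measureReal_mono hsub
  have h3 : μ.real (G ∪ Gᶜ) ≤ μ.real G + μ.real Gᶜ := measureReal_union_le _ _
  rw [Set.union_compl_self, probReal_univ] at h3
  linarith

/-- The rate in the theorem is the square root of `n ^ (-(2/3) (1 - κ))`, which dominates `β n`. -/
lemma le_sqrt_mul_rpow (hκ₁ : κ < 1)
    (hβ : ∀ n : ℕ, β n = ((n : ℝ) + 1) ^ (-((2 / 3) * (1 - κ)))) {n : ℕ} (hn : 1 ≤ n)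
    {y t : ℝ} (ht : 0 ≤ t) (h : y ^ 2 ≤ t * β n) :
    y ≤ √t * (n : ℝ) ^ (-(1 / 3 : ℝ) + κ / 3) := by
  have hn0 : (0 : ℝ) < n := by exact_mod_cast hn
  refine le_of_abs_le (abs_le_of_sq_le_sq (h.trans ?_) (by positivity))
  rw [mul_pow, Real.sq_sqrt ht, ← Real.rpow_mul_natCast hn0.le]
  gcongr
  rw [hβ, show (-(1 / 3 : ℝ) + κ / 3) * (2 : ℕ) = -((2 / 3) * (1 - κ)) by push_cast; ring]
  exact Real.rpow_le_rpow_of_nonpos hn0 (by linarith) (by linarith)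

end Main

end GTD

theorem corollary1 {S Act : Type*} [MeasurableSpace S] [MeasurableSpace Act] {d : ℕ}
    (E : GTD.PolicyEval S Act d)
    (hr : ∀ s, |E.r s| ≤ 1) (hφ : ∀ s, ‖E.φ s‖ ≤ 1) (hΦ : E.FullRank)
    (alg : GTD.Algorithm)
    (R₁ R₂ : ℝ) (hR₁ : 0 < R₁) (hR₂ : 0 < R₂)
    (hθ : ‖(alg.drift E).θstar‖ ≤ R₁ / 4)
    (hlam : ∀ θ : GTD.Vec d, ‖θ‖ ≤ R₁ / 2 → ‖(alg.drift E).lam θ‖ ≤ R₂ / 4)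
    (κ : ℝ) (hκ₀ : 0 < κ) (hκ₁ : κ < 1)
    (α β : ℕ → ℝ)
    (hα : ∀ n : ℕ, α n = ((n : ℝ) + 1) ^ (-(1 - κ)))
    (hβ : ∀ n : ℕ, β n = ((n : ℝ) + 1) ^ (-((2 / 3) * (1 - κ)))) :
    -- for each confidence level, the error is of the order `n ^ (-1/3 + κ/3)`
    (∀ δ : ℝ, 0 < δ → δ < 1 → ∃ K : ℝ, 0 < K ∧
      ∀ {Ω : Type*} [MeasurableSpace Ω] (μ : Measure Ω) [IsProbabilityMeasure μ]
        (X : ℕ → Ω → S × S) (θ₀ w₀ : Ω → GTD.Vec d), GTD.IsRun E μ X θ₀ w₀ →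
        ∀ n : ℕ, 1 ≤ n →
          1 - δ ≤ μ.real {ω | alg.err E
              (alg.iter E α β R₁ R₂ (fun k => X k ω) (θ₀ ω) (w₀ ω) n)
            ≤ K * (n : ℝ) ^ (-(1 / 3 : ℝ) + κ / 3)}) ∧
    -- with constants that depend neither on `n` nor on `δ`, at the price of a logarithm
    (∃ K c : ℝ, 0 < K ∧ 0 < c ∧
      ∀ {Ω : Type*} [MeasurableSpace Ω] (μ : Measure Ω) [IsProbabilityMeasure μ]
        (X : ℕ → Ω → S × S) (θ₀ w₀ : Ω → GTD.Vec d), GTD.IsRun E μ X θ₀ w₀ →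
        ∀ n : ℕ, 3 < n → ∀ δ : ℝ, δ < 1 →
          Real.exp (-c * (n : ℝ) ^ ((2 / 3) * (1 - κ))) ≤ δ →
          1 - δ ≤ μ.real {ω | alg.err E
              (alg.iter E α β R₁ R₂ (fun k => X k ω) (θ₀ ω) (w₀ ω) n)
            ≤ K * ((n : ℝ) ^ (-(1 / 3 : ℝ) + κ / 3) * √(Real.log (n / δ)))}) := by
  open GTD in
  have hb : 0 < 2 / 3 * (1 - κ) := by linarith
  constructor
  · intro δ hδ0 hδ1
    obtain ⟨M, s, c, hM, hs, hc, N₁, hdev⟩ := exists_deviation_le (alg := alg) hr hφ hΦ hR₁ hR₂ hθ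
      hlam hκ₀ hκ₁ hα hβ
    obtain ⟨N₂, hN₂⟩ := Filter.eventually_atTop.mp (eventually_exp_neg_rpow_le hb hc hδ0)
    obtain ⟨D, hD0, hD⟩ := exists_err_le_mul_rpow (α := α) (β := β) (alg := alg) hr hφ hR₁ hR₂
      (-(1 / 3 : ℝ) + κ / 3) (max N₁ N₂)
    -- Chosen so that `M * exp (-(s * t)) ≤ δ / 2`; the absolute value ensures `0 ≤ t`.
    set t := |Real.log (2 * M / δ)| / s with ht
    have ht0 : 0 ≤ t := by positivity
    refine ⟨√t + D + 1, by positivity, fun μ _ X θ₀ w₀ hrun n hn => ?_⟩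
    by_cases hnN : n < max N₁ N₂
    · refine le_measureReal_of_measure_compl_le (B := ∅) hδ0.le (fun ω hω => hω ?_) (by simp)
      refine (hD n hn hnN _ _ _).trans ?_
      gcongr
      linarith [Real.sqrt_nonneg t]
    · push Not at hnN
      refine le_measureReal_of_measure_compl_le hδ0.le (fun ω hω => ?_)
        ((hdev μ X θ₀ w₀ hrun n ((le_max_left _ _).trans hnN) t).trans
          (ENNReal.ofReal_le_ofReal ?_))
      · by_contra hle
        refine hω ((le_sqrt_mul_rpow hκ₁ hβ hn ht0 (not_lt.mp hle)).trans ?_)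
        gcongr
        linarith
      · have e1 := hN₂ n ((le_max_right _ _).trans hnN)
        have e2 : M * Real.exp (-(s * t)) ≤ δ / 2 := by
          have : s * t = |Real.log (2 * M / δ)| := by rw [ht]; field_simp
          calc M * Real.exp (-(s * t)) ≤ M * Real.exp (-Real.log (2 * M / δ)) := by
                rw [this]; gcongr; exact le_abs_self _
            _ = δ / 2 := by
                rw [Real.exp_neg, Real.exp_log (by positivity)]; field_simp
        linarith
  · obtain ⟨M, s, c, hM, hs, hc, N₁, hdev⟩ := exists_deviation_le (alg := alg) hr hφ hΦ hR₁ hR₂ hθ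
      hlam hκ₀ hκ₁ hα hβ
    -- With `t = log (n / δ) / s` the tail is `M * δ / n`, at most `δ / 2` once `n ≥ 2 * M`; thus
    -- the threshold does not depend on `δ`.
    obtain ⟨N₂, hN₂⟩ := exists_nat_ge (2 * M)
    obtain ⟨D, hD0, hD⟩ := exists_err_le_mul_rpow (α := α) (β := β) (alg := alg) hr hφ hR₁ hR₂
      (-(1 / 3 : ℝ) + κ / 3) (max N₁ N₂)
    refine ⟨√s⁻¹ + D + 1, c, by positivity, hc, fun μ _ X θ₀ w₀ hrun n hn δ hδ1 hδ => ?_⟩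
    have hδ0 : 0 < δ := (Real.exp_pos _).trans_le hδ
    have hn4 : (4 : ℝ) ≤ n := by exact_mod_cast hn
    -- As `n ≥ 4 > e` and `δ < 1`, the logarithmic factor is at least `1`, so it can be inserted
    -- into the bound for early times.
    have hlog : 1 ≤ Real.log (n / δ) := by
      rw [Real.le_log_iff_exp_le (by positivity)]
      have := Real.exp_one_lt_d9
      rw [le_div_iff₀ hδ0]
      nlinarith [Real.exp_pos 1]
    have hlog0 : 0 ≤ Real.log (n / δ) := by linarith
    by_cases hnN : n < max N₁ N₂
    · refine le_measureReal_of_measure_compl_le (B := ∅) hδ0.le (fun ω hω => hω ?_) (by simp)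
      refine (hD n (by omega) hnN _ _ _).trans ?_
      have h1 : 1 ≤ √(Real.log (n / δ)) := Real.one_le_sqrt.mpr hlog
      calc D * (n : ℝ) ^ (-(1 / 3 : ℝ) + κ / 3) = D * ((n : ℝ) ^ (-(1 / 3 : ℝ) + κ / 3) * 1) := by
            rw [mul_one]
        _ ≤ _ := by
            gcongr
            linarith [Real.sqrt_nonneg s⁻¹]
    · push Not at hnN
      refine le_measureReal_of_measure_compl_le hδ0.le (fun ω hω => ?_)
        ((hdev μ X θ₀ w₀ hrun n ((le_max_left _ _).trans hnN) (s⁻¹ * Real.log (n / δ))).trans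
          (ENNReal.ofReal_le_ofReal ?_))
      · by_contra hle
        refine hω ((le_sqrt_mul_rpow hκ₁ hβ (by omega) (by positivity) (not_lt.mp hle)).trans ?_)
        rw [Real.sqrt_mul (by positivity), mul_assoc, mul_comm (√(Real.log (n / δ)))]
        gcongr
        linarith
      · have hnM : 2 * M ≤ n := hN₂.trans (by exact_mod_cast (le_max_right _ _).trans hnN)
        have e2 : M * Real.exp (-(s * (s⁻¹ * Real.log (n / δ)))) ≤ δ / 2 := by
          rw [mul_inv_cancel_left₀ hs.ne', Real.exp_neg, Real.exp_log (by positivity), inv_div,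
            ← mul_div_assoc, div_le_iff₀ (by positivity)]
          nlinarith
        linarith
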